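/- Let $K$ be a non-archimedean local field of characteristic $p>0$ with ring of integers $\mathfrak D$, residue field of order $q=p^c$, prime element $\mathfrak p$ (an element of maximal valuation in $\{|x|<1\}$), and Haar measure $\mu$ on $(K,+)$ with $\mu(\mathfrak D)=1$. Let $1=\epsilon_0,\epsilon_1,\dots,\epsilon_{c-1}\in K$ be such that their span over $\mathbb F_p$ is a subfield of $K$ with $q$ elements. For $0\le n<q$ with base-$p$ expansion $n=\sum_{k<c}a_kp^k$ put $u(n)=\big(\sum_{k<c}a_k\epsilon_k\big)\mathfrak p^{-1}$, and for $n\ge q$ with base-$q$ expansion $n=\sum_k b_kq^k$ put $u(n)=\sum_k\mathfrak p^{-k}u(b_k)$. Let $\chi$ be a continuous unitary character of $(K,+)$ that is trivial on $\mathfrak D$ but not on $\mathfrak p^{-1}\mathfrak D$, and let $f\mapsto\hat f$ be the Fourier transform on $L^2(K)=L^2(K,\mu)$, i.e. the $L^2$-continuous extension of $\hat f(\xi)=\int_K f(x)\chi(-\xi x)\,d\mu(x)$ from $L^1(K)\cap L^2(K)$. A multiresolution analysis (MRA) with scaling function $\phi$ is a sequence $(V_j)_{j\in\mathbb Z}$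 of closed subspaces of $L^2(K)$ with $V_j\subset V_{j+1}$ for all $j$, $\overline{\bigcup_jV_j}=L^2(K)$, $\bigcap_jV_j=\{0\}$, $f\in V_j\iff f(\mathfrak p^{-1}\,\cdot)\in V_{j+1}$ for all $j$, and $\phi\in V_0$ such that $\{\phi(\cdot-u(t)):t\in\mathbb N_0\}$ is an orthonormal basis of $V_0$. A measurable set $S\subset K$ is a scaling set if $\hat\phi=\mathbf 1_S$ a.e. for the scaling function $\phi$ of some MRA. Theorem. Let $S$ be a scaling set. Then $\mathfrak p^{-j}S$ increases to $K$ almost everywhere as $j\to\infty$: for every $j\in\mathbb Z$ we have $\mathfrak p^{-j}S\subset\mathfrak p^{-(j+1)}S$ up to a $\mu$-null set, and for almost every $\xi\in K$ we have $\xi\in\mathfrak p^{-j}S$ for all sufficiently large $j$. If moreover $\chi$ is the standard character, i.e. for $0\le k<c$ and $j\in\mathbb Z$, $\chi(\epsilon_k\mathfrak p^{-j})=e^{2\pi i/p}$ when $k=0$ and $j=1$, and $\chi(\epsilon_k\mathfrak p^{-j})=1$ otherwise, then the translates $S+u(t)$, $t\in\mathbb N_0$, are pairwise disjoint up to null sets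 and their union is $K$ up to a null set; in particular the sets $(S+u(t))\cap\mathfrak D$, $t\in\mathbb N_0$, form a partition of $\mathfrak D$ up to null sets. -/

import Mathlib

open MeasureTheory Filter Topology
open scoped Pointwise ValuativeRel ENNReal ComplexConjugate

noncomputable section

namespace LocalFieldMRA

variable {K : Type*} [Field K] [ValuativeRel K] [TopologicalSpace K]

/-- `ϖ` is a prime element of `K`: an element of maximal valuation in `{x : |x| < 1}`. -/
def IsPrimeElement (ϖ : K) : Prop :=
  ValuativeRel.valuation K ϖ < 1 ∧
    ∀ x : K, ValuativeRel.valuation K x < 1 →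
      ValuativeRel.valuation K x ≤ ValuativeRel.valuation K ϖ

/-- `ε 0 = 1` and `ε 0, …, ε (c - 1)` span (over the prime field) a subfield of `K` isomorphic to
`GF(p ^ c)`. Since `K` has characteristic `p`, the span over the prime field is the additive
subgroup that is generated. -/
def IsResidueBasis (p : ℕ) {c : ℕ} [NeZero c] (ε : Fin c → K) : Prop :=
  ε 0 = 1 ∧ ∃ F : Subfield K, Nat.card F = p ^ c ∧
    (F : Set K) = (AddSubgroup.closure (Set.range ε) : Set K)

/-- `u n` for `n < p ^ c`: if `n = ∑ a_k p ^ k` in base `p`, then `(∑ a_k ε_k) ϖ⁻¹`. -/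
def uDigit (p : ℕ) {c : ℕ} (ϖ : K) (ε : Fin c → K) (n : ℕ) : K :=
  (∑ k : Fin c, ((n / p ^ (k : ℕ) % p : ℕ) : K) * ε k) * ϖ⁻¹

/-- The translations `u n`: if `n = ∑ b_k q ^ k` in base `q = p ^ c`, then
`u n = ∑ ϖ ^ (-k) u(b_k)`. The digits `b_k` with `k > n` vanish. -/
def u (p : ℕ) {c : ℕ} (ϖ : K) (ε : Fin c → K) (n : ℕ) : K :=
  ∑ k ∈ Finset.range (n + 1),
    (ϖ⁻¹) ^ k * uDigit p ϖ ε (n / (p ^ c) ^ k % p ^ c)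

/-- `χ` is a continuous unitary character of `(K, +)` that is trivial on the ring of integers
`𝒪[K]` and not trivial on `ϖ⁻¹ 𝒪[K]`. -/
structure IsBaseCharacter (ϖ : K) (χ : AddChar K Circle) : Prop where
  continuous : Continuous χ
  trivial_on_integers : ∀ x ∈ 𝒪[K], χ x = 1
  nontrivial : ∃ x ∈ 𝒪[K], χ (ϖ⁻¹ * x) ≠ 1

/-- The values `χ(ε_k ϖ ^ (-j)) = exp(2πi/p)` if `k = 0`, `j = 1`, and `1` in all other cases,
which single out the standard character. -/
def HasStandardValues (p : ℕ) {c : ℕ} [NeZero c] (ϖ : K) (ε : Fin c → K)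
    (χ : AddChar K Circle) : Prop :=
  ∀ (k : Fin c) (j : ℤ), χ (ε k * ϖ ^ (-j)) =
    if k = 0 ∧ j = 1 then Circle.exp (2 * Real.pi / p) else 1

variable [MeasurableSpace K]

/-- `g` is the Fourier transform of `f ∈ L²(K)`: the pair `(f, g)` is an `L²` limit of pairs
`(f_n, 𝓕 f_n)` with `f_n ∈ L¹(K) ∩ L²(K)`, where `𝓕 f_n (ξ) = ∫ f_n(x) χ(-ξ x) dx`. -/
def IsFourierTransform (χ : AddChar K Circle) (μ : Measure K) (f g : K → ℂ) : Prop :=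
  MemLp f 2 μ ∧ MemLp g 2 μ ∧ ∃ F : ℕ → K → ℂ,
    (∀ n, MemLp (F n) 1 μ ∧ MemLp (F n) 2 μ) ∧
    Tendsto (fun n => eLpNorm (F n - f) 2 μ) atTop (𝓝 0) ∧
    Tendsto (fun n => eLpNorm (Fourier.fourierIntegral χ μ (F n) - g) 2 μ) atTop (𝓝 0)

variable [BorelSpace K] [IsNonarchimedeanLocalField K]

/-- The translate `x ↦ f (x - a)` of `f ∈ L²(K)`. -/
def translate (μ : Measure K) [μ.IsAddHaarMeasure] (a : K) (f : Lp ℂ 2 μ) : Lp ℂ 2 μ :=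
  Lp.compMeasurePreserving (fun x => x - a) (measurePreserving_sub_right μ a) f

/-- `(V j)` is a multiresolution analysis of `L²(K)` with scaling function `φ`, for the dilation
`f ↦ f(ϖ⁻¹ ·)` and the translations by `w n`, `n ∈ ℕ`. -/
structure IsMRA (μ : Measure K) [μ.IsAddHaarMeasure] (ϖ : K) (w : ℕ → K)
    (V : ℤ → Submodule ℂ (Lp ℂ 2 μ)) (φ : Lp ℂ 2 μ) : Prop where
  isClosed : ∀ j, IsClosed (V j : Set (Lp ℂ 2 μ))
  mono : ∀ j, V j ≤ V (j + 1)
  dense : closure (⋃ j, (V j : Set (Lp ℂ 2 μ))) = Set.univ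
  inter : ⋂ j, (V j : Set (Lp ℂ 2 μ)) = {0}
  dilation : ∀ (j : ℤ) (f g : Lp ℂ 2 μ), (g =ᵐ[μ] fun x => f (ϖ⁻¹ * x)) →
    (f ∈ V j ↔ g ∈ V (j + 1))
  orthonormal : Orthonormal ℂ (fun n => translate μ (w n) φ)
  span_eq : (Submodule.span ℂ (Set.range fun n => translate μ (w n) φ)).topologicalClosure = V 0

/-- A scaling set: a measurable `S` with `φ̂ = 𝟙_S` (almost everywhere) for the scaling function
`φ` of some multiresolution analysis of `L²(K)`. -/
def IsScalingSet (μ : Measure K) [μ.IsAddHaarMeasure] (χ : AddChar K Circle) (ϖ : K) (w : ℕ → K)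
    (S : Set K) : Prop :=
  MeasurableSet S ∧ ∃ (V : ℤ → Submodule ℂ (Lp ℂ 2 μ)) (φ : Lp ℂ 2 μ),
    IsMRA μ ϖ w V φ ∧ IsFourierTransform χ μ φ (S.indicator fun _ => (1 : ℂ))

end LocalFieldMRA

end

/-! On the Fourier side the translate of `φ` by `a` becomes `χ(-aξ) 𝟙_S(ξ)`. So the transforms of
functions in `V 0` live on `S`, and by dilation those of `V n`, `n ≥ 0`, live on `ϖ^(-n) S`
(`IsMRA.fourierL2_eq_zero`). A translate of `φ` lies in `V 1` and has unimodular transform on `S`,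
whence `S ⊂ ϖ⁻¹ S` almost everywhere. If the sets `ϖ^(-n) S` missed a set of positive measure,
density would make every transform vanish there; but the indicator of a small ball has a nonzero
constant transform on a large ball. All this needs the Fourier transform only as an isometry of
`L²`, which is obtained from Plancherel's theorem on `L¹ ∩ L²`.

For the tiling, the values of `u` form the group `Λ` of finite sums `∑ a_i ϖ^(-i-1)` with `a_i` in
the finite field `F`. A product of two such sums involves only exponents at most `-2`, so the
standard character is trivial on it; since `Λ + 𝒪 = K`, this makes `Λ` its own annihilator, with a
finite version at each level (`forall_char_latticeHom_mul_eq_one_iff`). Orthonormality says that `μ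
S = 1` and that `χ(λ ·)` integrates to zero over `S` for `0 ≠ λ ∈ Λ`. Summing over the characters
given by `Λ ∩ ϖ^(-k) 𝒪` then shows that the measure `∑ μ|_(u n + S)` gives each coset of `ϖ^k 𝒪` the
mass `q^(-k)`. The same computation applies to `𝒪`, which tiles because `Λ ∩ 𝒪 = 0` and `Λ + 𝒪 = K`.
Cosets determine a measure, so the sum is `μ`, and this one identity contains both disjointness and
covering. -/

set_option linter.unusedSectionVars false

namespace LocalFieldMRA

open ValuativeRel

/-! ### Discreteness of the valuation, fractional ideals, and the conductor of `χ`. -/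

section Valuation

variable {K : Type*} [Field K] [ValuativeRel K] [TopologicalSpace K] [IsNonarchimedeanLocalField K]
  {ϖ : K} {χ : AddChar K Circle}

theorem IsPrimeElement.ne_zero (hϖ : IsPrimeElement ϖ) : ϖ ≠ 0 := by
  rintro rfl
  obtain ⟨r, hr, hr'⟩ := Valuation.IsNontrivial.exists_lt_one (v := valuation K)
  have := hϖ.2 r hr'
  rw [map_zero, le_zero_iff, map_eq_zero] at this
  exact hr this

theorem IsPrimeElement.valuation_pos (hϖ : IsPrimeElement ϖ) : 0 < valuation K ϖ := by
  simpa [zero_lt_iff] using hϖ.ne_zero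

theorem IsPrimeElement.zpow_le_zpow_iff (hϖ : IsPrimeElement ϖ) {m n : ℤ} :
    valuation K ϖ ^ m ≤ valuation K ϖ ^ n ↔ n ≤ m :=
  zpow_le_zpow_iff_right_of_lt_one₀ hϖ.valuation_pos hϖ.1

theorem IsPrimeElement.exists_le_zpow (hϖ : IsPrimeElement ϖ) (x : K) :
    ∃ n : ℕ, valuation K x ≤ valuation K ϖ ^ (-(n : ℤ)) := by
  have : MulArchimedean (ValueGroupWithZero K) :=
    ValuativeRel.isRankLeOne_iff_mulArchimedean.mp inferInstance
  obtain ⟨n, hn⟩ := MulArchimedean.arch (valuation K x)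
    (y := (valuation K ϖ)⁻¹) ((one_lt_inv₀ hϖ.valuation_pos).2 hϖ.1)
  exact ⟨n, by simpa using hn⟩

/-- Take the greatest `n` with `|x| ≤ |ϖ|^n`. If the inequality were strict, `x ϖ^(-n)` would have
valuation below `1`, hence at most `|ϖ|`, and `n + 1` would also qualify. -/
theorem IsPrimeElement.exists_eq_zpow (hϖ : IsPrimeElement ϖ) {x : K} (hx : x ≠ 0) :
    ∃ n : ℤ, valuation K x = valuation K ϖ ^ n := by
  have hx' : 0 < valuation K x := by simpa [zero_lt_iff] using hx
  obtain ⟨a, ha⟩ := hϖ.exists_le_zpow x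
  obtain ⟨b, hb⟩ := hϖ.exists_le_zpow x⁻¹
  have hb' : valuation K ϖ ^ (b : ℤ) ≤ valuation K x := by
    rw [map_inv₀, zpow_neg] at hb
    exact (inv_le_inv₀ hx' (zpow_pos hϖ.valuation_pos _)).1 hb
  obtain ⟨n, hn, hmax⟩ := Int.exists_greatest_of_bdd
    (P := fun n : ℤ => valuation K x ≤ valuation K ϖ ^ n)
    ⟨(b : ℤ), fun z hz => hϖ.zpow_le_zpow_iff.1 (hb'.trans hz)⟩ ⟨_, ha⟩
  refine ⟨n, le_antisymm hn (not_lt.1 fun hlt => ?_)⟩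
  have h0 := hϖ.valuation_pos
  have h1 : valuation K (x * ϖ ^ (-n)) < 1 := by
    rw [map_mul, map_zpow₀, zpow_neg, mul_inv_lt_iff₀ (zpow_pos h0 _), one_mul]
    exact hlt
  have h2 := hϖ.2 _ h1
  rw [map_mul, map_zpow₀, zpow_neg, mul_inv_le_iff₀ (zpow_pos h0 _), ← zpow_one_add₀ h0.ne'] at h2
  have := hmax _ h2
  omega

/-- The fractional ideal `ϖ ^ k 𝒪[K]`, as an additive subgroup. -/
def fracIdeal (ϖ : K) (k : ℤ) : AddSubgroup K where
  carrier := {x | valuation K x ≤ valuation K ϖ ^ k}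
  zero_mem' := by simp
  add_mem' ha hb := by
    rw [Set.mem_ofPred_eq] at ha hb ⊢
    exact (Valuation.map_add _ _ _).trans (max_le ha hb)
  neg_mem' ha := by simpa using ha

theorem mem_fracIdeal {k : ℤ} {x : K} :
    x ∈ fracIdeal ϖ k ↔ valuation K x ≤ valuation K ϖ ^ k := by
  rw [← SetLike.mem_coe]
  exact iff_of_eq (Set.mem_ofPred_eq ..)

theorem mem_fracIdeal_zero {x : K} : x ∈ fracIdeal ϖ 0 ↔ x ∈ 𝒪[K] := by
  simp [mem_fracIdeal, Valuation.mem_integer_iff]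

theorem coe_fracIdeal_zero : (fracIdeal ϖ 0 : Set K) = (𝒪[K] : Set K) := by
  ext x
  exact mem_fracIdeal_zero

theorem fracIdeal_anti (hϖ : IsPrimeElement ϖ) : Antitone (fracIdeal ϖ) :=
  fun _ _ h _ hx =>
    mem_fracIdeal.2 ((mem_fracIdeal.1 hx).trans (hϖ.zpow_le_zpow_iff.2 h))

theorem mul_mem_fracIdeal (hϖ : IsPrimeElement ϖ) {m n : ℤ} {x y : K} (hx : x ∈ fracIdeal ϖ m)
    (hy : y ∈ fracIdeal ϖ n) : x * y ∈ fracIdeal ϖ (m + n) := by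
  rw [mem_fracIdeal, map_mul, zpow_add₀ hϖ.valuation_pos.ne']
  exact mul_le_mul' (mem_fracIdeal.1 hx) (mem_fracIdeal.1 hy)

theorem zpow_mem_fracIdeal (k : ℤ) : ϖ ^ k ∈ fracIdeal ϖ k := by
  simp [mem_fracIdeal]

theorem zpow_mul_mem_fracIdeal_iff (hϖ : IsPrimeElement ϖ) {m k : ℤ} {x : K} :
    ϖ ^ m * x ∈ fracIdeal ϖ k ↔ x ∈ fracIdeal ϖ (k - m) := by
  constructor <;> intro h
  · have := mul_mem_fracIdeal hϖ (zpow_mem_fracIdeal (ϖ := ϖ) (-m)) h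
    rwa [← mul_assoc, ← zpow_add₀ hϖ.ne_zero, neg_add_cancel, zpow_zero, one_mul,
      neg_add_eq_sub] at this
  · simpa using mul_mem_fracIdeal hϖ (zpow_mem_fracIdeal (ϖ := ϖ) m) h

theorem zpow_smul_fracIdeal (hϖ : IsPrimeElement ϖ) (m k : ℤ) :
    (ϖ ^ m • (fracIdeal ϖ k : Set K)) = fracIdeal ϖ (m + k) := by
  ext x
  rw [Set.mem_smul_set_iff_inv_smul_mem₀ (zpow_ne_zero _ hϖ.ne_zero), ← zpow_neg, smul_eq_mul,
    SetLike.mem_coe, zpow_mul_mem_fracIdeal_iff hϖ, SetLike.mem_coe, sub_neg_eq_add, add_comm]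

theorem exists_mem_fracIdeal (hϖ : IsPrimeElement ϖ) (x : K) :
    ∃ n : ℕ, x ∈ fracIdeal ϖ (-(n : ℤ)) := by
  simpa only [mem_fracIdeal] using hϖ.exists_le_zpow x

theorem iUnion_fracIdeal (hϖ : IsPrimeElement ϖ) :
    ⋃ n : ℕ, (fracIdeal ϖ (-(n : ℤ)) : Set K) = Set.univ :=
  Set.eq_univ_of_forall fun x => Set.mem_iUnion.2 (exists_mem_fracIdeal hϖ x)

theorem isCompact_fracIdeal (k : ℤ) : IsCompact (fracIdeal ϖ k : Set K) := by
  convert IsNonarchimedeanLocalField.isCompact_closedBall K (valuation K ϖ ^ k)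
  ext x
  simp [mem_fracIdeal]

theorem hasBasis_nhds_zero_fracIdeal (hϖ : IsPrimeElement ϖ) :
    (𝓝 (0 : K)).HasBasis (fun _ : ℕ => True) fun n => (fracIdeal ϖ (n : ℤ) : Set K) := by
  refine (IsValuativeTopology.hasBasis_nhds_zero' K).to_hasBasis (fun γ hγ => ?_) fun n _ => ?_
  · obtain ⟨r, rfl⟩ := ValuativeRel.valuation_surjective γ
    have hr : r ≠ 0 := by simpa using hγ
    obtain ⟨m, hm⟩ := hϖ.exists_eq_zpow hr
    -- The basic neighbourhoods are given by strict inequalities, the fractional ideals by weak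
    -- ones; hence the shift by one.
    refine ⟨(m + 1).toNat, trivial, fun x hx => ?_⟩
    rw [Set.mem_ofPred_eq, hm]
    refine lt_of_le_of_lt (mem_fracIdeal.1 hx) ?_
    rw [zpow_lt_zpow_iff_right_of_lt_one₀ hϖ.valuation_pos hϖ.1]
    omega
  · refine ⟨valuation K ϖ ^ (n : ℤ), (zpow_pos hϖ.valuation_pos _).ne', fun x hx => ?_⟩
    rw [Set.mem_ofPred_eq] at hx
    exact mem_fracIdeal.2 hx.le

theorem isOpen_fracIdeal (hϖ : IsPrimeElement ϖ) (k : ℤ) : IsOpen (fracIdeal ϖ k : Set K) := by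
  refine AddSubgroup.isOpen_of_mem_nhds _ (g := 0) ?_
  refine mem_of_superset ((hasBasis_nhds_zero_fracIdeal hϖ).mem_of_mem (i := k.toNat) trivial) ?_
  exact fracIdeal_anti hϖ (Int.self_le_toNat k)

theorem IsBaseCharacter.eq_one (hχ : IsBaseCharacter ϖ χ) {x : K} (hx : x ∈ fracIdeal ϖ 0) :
    χ x = 1 :=
  hχ.trivial_on_integers x (mem_fracIdeal_zero.1 hx)

/-- Duality of balls: the annihilator of `ϖ^(-k) 𝒪` is no larger than `ϖ^k 𝒪`. The witness is chosen
so that its product with `x` is the given element of `ϖ⁻¹ 𝒪` on which `χ` is nontrivial. -/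
theorem IsBaseCharacter.exists_ne_one (hϖ : IsPrimeElement ϖ) (hχ : IsBaseCharacter ϖ χ) {k : ℤ}
    {x : K} (hx : x ∉ fracIdeal ϖ k) : ∃ y ∈ fracIdeal ϖ (-k), χ (x * y) ≠ 1 := by
  have hx0 : x ≠ 0 := by
    rintro rfl
    exact hx (zero_mem _)
  obtain ⟨j, hj⟩ := hϖ.exists_eq_zpow hx0
  have hjk : j < k := by
    rw [mem_fracIdeal, hj, hϖ.zpow_le_zpow_iff] at hx
    omega
  obtain ⟨y, hy, hy'⟩ := hχ.nontrivial
  refine ⟨ϖ⁻¹ * y / x, ?_, by rwa [mul_div_cancel₀ _ hx0]⟩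
  have h1 : ϖ⁻¹ * y ∈ fracIdeal ϖ (-1 + 0) :=
    mul_mem_fracIdeal hϖ (by simpa using zpow_mem_fracIdeal (ϖ := ϖ) (-1)) (mem_fracIdeal_zero.2 hy)
  have h2 : x⁻¹ ∈ fracIdeal ϖ (-j) := by
    rw [mem_fracIdeal, map_inv₀, hj, zpow_neg]
  rw [div_eq_mul_inv]
  exact fracIdeal_anti hϖ (by omega) (mul_mem_fracIdeal hϖ h1 h2)

end Valuation

/-- The ideals `ϖ^n 𝒪` make `K` first countable, hence pseudometrizable, and exhaust it by compact
sets. Second countability makes Borel structures compatible with products and with countable bases.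
-/
theorem secondCountableTopology {K : Type*} [Field K] [ValuativeRel K] [TopologicalSpace K]
    [IsNonarchimedeanLocalField K] {ϖ : K} (hϖ : IsPrimeElement ϖ) :
    SecondCountableTopology K := by
  let := IsTopologicalAddGroup.rightUniformSpace K
  have := isUniformAddGroup_of_addCommGroup (G := K)
  have : (𝓝 (0 : K)).IsCountablyGenerated :=
    HasCountableBasis.isCountablyGenerated ⟨hasBasis_nhds_zero_fracIdeal hϖ, Set.to_countable _⟩
  have : (uniformity K).IsCountablyGenerated := IsUniformAddGroup.uniformity_countably_generated
  let := UniformSpace.pseudoMetricSpace K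
  have : SigmaCompactSpace K := ⟨⟨fun n : ℕ => fracIdeal ϖ (-(n : ℤ)),
    fun n => isCompact_fracIdeal _, iUnion_fracIdeal hϖ⟩⟩
  exact EMetric.secondCountable_of_sigmaCompact K

/-! ### Plancherel's theorem for integrable functions in `L²`. -/

section Plancherel

variable {K : Type*} [Field K] [ValuativeRel K] [TopologicalSpace K] [IsNonarchimedeanLocalField K]
  [MeasurableSpace K] [BorelSpace K] [SecondCountableTopology K]
  {μ : Measure K} [μ.IsAddHaarMeasure] {ϖ : K} {χ : AddChar K Circle}

theorem measure_smul_eq (μ : Measure K) [μ.IsAddHaarMeasure] (a : Kˣ) (s : Set K) :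
    μ ((a : K) • s) = distribHaarChar K a * μ s :=
  (distribHaarChar_mul μ a s).symm

theorem measure_fracIdeal (hϖ : IsPrimeElement ϖ) (hμ : μ (𝒪[K] : Set K) = 1) (k : ℤ) :
    μ (fracIdeal ϖ k : Set K) = distribHaarChar K (Units.mk0 ϖ hϖ.ne_zero ^ k) := by
  have h := measure_smul_eq μ (Units.mk0 ϖ hϖ.ne_zero ^ k) (fracIdeal ϖ 0 : Set K)
  rw [coe_fracIdeal_zero, hμ, mul_one, ← coe_fracIdeal_zero (ϖ := ϖ), Units.val_zpow_eq_zpow_val,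
    Units.val_mk0, zpow_smul_fracIdeal hϖ, add_zero] at h
  exact h

/-- Both factors are values of the modulus character at mutually inverse elements. This is where the
normalisation of `μ` enters Plancherel's theorem. -/
theorem measureReal_fracIdeal_mul (hϖ : IsPrimeElement ϖ) (hμ : μ (𝒪[K] : Set K) = 1) (k : ℤ) :
    μ.real (fracIdeal ϖ (-k) : Set K) * μ.real (fracIdeal ϖ k : Set K) = 1 := by
  rw [measureReal_def, measureReal_def, measure_fracIdeal hϖ hμ, measure_fracIdeal hϖ hμ,
    ENNReal.coe_toReal, ENNReal.coe_toReal, ← NNReal.coe_mul, ← map_mul, zpow_neg, inv_mul_cancel,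
    map_one, NNReal.coe_one]

theorem measure_fracIdeal_lt_top (k : ℤ) : μ (fracIdeal ϖ k : Set K) < ∞ :=
  (isCompact_fracIdeal k).measure_lt_top

theorem measurableSet_fracIdeal (hϖ : IsPrimeElement ϖ) (k : ℤ) :
    MeasurableSet (fracIdeal ϖ k : Set K) := (isOpen_fracIdeal hϖ k).measurableSet

theorem setIntegral_char_fracIdeal (hϖ : IsPrimeElement ϖ) (hχ : IsBaseCharacter ϖ χ) (k : ℤ)
    (x : K) : ∫ ξ in (fracIdeal ϖ (-k) : Set K), (χ (x * ξ) : ℂ) ∂μ =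
      (fracIdeal ϖ k : Set K).indicator (fun _ => (μ.real (fracIdeal ϖ (-k) : Set K) : ℂ)) x := by
  have hm : MeasurableSet (fracIdeal ϖ (-k) : Set K) := (isOpen_fracIdeal hϖ _).measurableSet
  by_cases hx : x ∈ fracIdeal ϖ k
  · rw [Set.indicator_of_mem (SetLike.mem_coe.2 hx), setIntegral_congr_fun hm (g := fun _ => (1 : ℂ))]
    · simp
    · intro ξ hξ
      have : x * ξ ∈ fracIdeal ϖ 0 := by simpa using mul_mem_fracIdeal hϖ hx hξ
      simp [hχ.eq_one this]
  · rw [Set.indicator_of_notMem (by simpa using hx)]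
    obtain ⟨y, hy, hy'⟩ := hχ.exists_ne_one hϖ hx
    set I := ∫ ξ in (fracIdeal ϖ (-k) : Set K), (χ (x * ξ) : ℂ) ∂μ with hI
    -- Translating by `y` preserves the ball and multiplies the integrand by `χ(xy) ≠ 1`, so the
    -- integral vanishes.
    have h : I = χ (x * y) * I := by
      rw [hI, ← integral_indicator hm, ← integral_const_mul,
        ← integral_add_left_eq_self (μ := μ) _ y]
      refine integral_congr_ae (Eventually.of_forall fun ξ => ?_)
      by_cases hξ : ξ ∈ fracIdeal ϖ (-k)
      · have : y + ξ ∈ fracIdeal ϖ (-k) := add_mem hy hξ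
        simp [Set.indicator_of_mem, hξ, this, mul_add, AddChar.map_add_eq_mul]
      · have : y + ξ ∉ fracIdeal ϖ (-k) := by rwa [add_mem_cancel_left hy]
        simp [hξ, this]
    have h2 : (1 - (χ (x * y) : ℂ)) * I = 0 := by rw [sub_mul, one_mul, ← h, sub_self]
    refine (mul_eq_zero.1 h2).resolve_left fun h3 => hy' ?_
    exact Subtype.ext (sub_eq_zero.1 h3).symm

theorem continuous_fourierIntegral (hc : Continuous χ) {F : K → ℂ} (hF : Integrable F μ) :
    Continuous (Fourier.fourierIntegral χ μ F) :=
  VectorFourier.fourierIntegral_continuous hc (L := LinearMap.mul K K)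
    (by simpa using continuous_mul) hF

theorem conj_mul_fourierIntegral (F : K → ℂ) (ξ : K) :
    conj (Fourier.fourierIntegral χ μ F ξ) * Fourier.fourierIntegral χ μ F ξ =
      ∫ z : K × K, (conj (F z.1) * F z.2) * χ ((z.1 - z.2) * ξ) ∂(μ.prod μ) := by
  rw [Fourier.fourierIntegral_def, ← integral_conj, ← integral_prod_mul]
  refine integral_congr_ae (Eventually.of_forall fun z => ?_)
  have : (z.1 - z.2) * ξ = z.1 * ξ + -(z.2 * ξ) := by ring
  simp only [this, AddChar.map_add_eq_mul, Circle.smul_def, smul_eq_mul, map_mul,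
    AddChar.map_neg_eq_inv, Circle.coe_mul, Circle.coe_inv_eq_conj, Complex.conj_conj]
  ring

/-- By Fubini, integrating the character over the large ball `ϖ^(-k) 𝒪` localises the double
integral to differences in the small ball `ϖ^k 𝒪`. The right side is an average of the
autocorrelation of `F` near `0`. -/
theorem setIntegral_conj_mul_fourierIntegral (hϖ : IsPrimeElement ϖ) (hχ : IsBaseCharacter ϖ χ)
    {F : K → ℂ} (hF : Integrable F μ) (k : ℤ) :
    ∫ ξ in (fracIdeal ϖ (-k) : Set K),
      conj (Fourier.fourierIntegral χ μ F ξ) * Fourier.fourierIntegral χ μ F ξ ∂μ =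
    μ.real (fracIdeal ϖ (-k) : Set K) *
      ∫ h in (fracIdeal ϖ k : Set K), ∫ x, conj (F x) * F (x + h) ∂μ ∂μ := by
  have hH : Integrable (fun z : K × K => conj (F z.1) * F z.2) (μ.prod μ) :=
    Integrable.mul_prod (f := fun x => conj (F x))
      (Complex.conjLIE.toContinuousLinearEquiv.toContinuousLinearMap.integrable_comp hF) hF
  have hm : MeasurableSet (fracIdeal ϖ k : Set K) := (isOpen_fracIdeal hϖ _).measurableSet
  have : IsFiniteMeasure (μ.restrict (fracIdeal ϖ (-k) : Set K)) :=
    ⟨by simpa using measure_fracIdeal_lt_top _⟩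
  simp_rw [conj_mul_fourierIntegral]
  rw [integral_integral_swap]
  · simp_rw [integral_const_mul, setIntegral_char_fracIdeal hϖ hχ]
    set c : ℂ := (μ.real (fracIdeal ϖ (-k) : Set K) : ℂ)
    have hG : Integrable (fun z : K × K => (conj (F z.1) * F z.2) *
        (fracIdeal ϖ k : Set K).indicator (fun _ => c) (z.1 - z.2)) (μ.prod μ) := by
      refine hH.mul_bdd (c := ‖c‖) ?_ (Eventually.of_forall fun z => ?_)
      · exact ((measurable_const.indicator hm).comp
          (measurable_fst.sub measurable_snd)).aestronglyMeasurable
      · exact norm_indicator_le_norm_self _ _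
    -- The shear `(x, h) ↦ (x, x + h)` turns the difference of the coordinates into `-h`.
    have hp := measurePreserving_prod_add μ μ
    rw [← hp.integral_comp (MeasurableEquiv.shearAddRight K).measurableEmbedding,
      integral_prod_symm, ← integral_indicator hm, ← integral_const_mul]
    · refine integral_congr_ae (Eventually.of_forall fun h => ?_)
      simp only [sub_add_cancel_left]
      by_cases hh : h ∈ fracIdeal ϖ k
      · simp [hh, integral_mul_const, mul_comm c]
      · simp [hh]
    · exact (hp.integrable_comp hG.aestronglyMeasurable).2 hG
  · have h1 : Integrable (fun w : K × (K × K) => (1 : ℂ) * (conj (F w.2.1) * F w.2.2))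
      ((μ.restrict (fracIdeal ϖ (-k) : Set K)).prod (μ.prod μ)) :=
      Integrable.mul_prod (f := fun _ => (1 : ℂ)) (integrable_const _) hH
    simp only [one_mul] at h1
    refine h1.mul_bdd (c := 1) ?_ (Eventually.of_forall fun w => (Circle.norm_coe _).le)
    have : Continuous fun w : K × (K × K) => (χ ((w.2.1 - w.2.2) * w.1) : ℂ) :=
      continuous_subtype_val.comp (hχ.continuous.comp (by fun_prop))
    exact this.aestronglyMeasurable

/-- This is the inner product of `F` with its translates, and translation is strongly continuous on
`L²`. -/
theorem continuous_autocorrelation {F : K → ℂ} (hF : MemLp F 2 μ) :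
    Continuous fun h => ∫ x, conj (F x) * F (x + h) ∂μ := by
  let g : C(K, C(K, K)) := (ContinuousMap.mk (fun a : K × K => a.2 + a.1) (by fun_prop)).curry
  have hg : ∀ h, MeasurePreserving (g h) μ μ := fun h => measurePreserving_add_right μ h
  have hc : Continuous fun h => Lp.compMeasurePreserving (g h) (hg h) (hF.toLp F) :=
    continuous_const.compMeasurePreservingLp g.continuous hg (by simp)
  have : (fun h => ∫ x, conj (F x) * F (x + h) ∂μ) = fun h =>
      inner ℂ (hF.toLp F) (Lp.compMeasurePreserving (g h) (hg h) (hF.toLp F)) := by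
    funext h
    rw [L2.inner_def]
    refine integral_congr_ae ?_
    filter_upwards [hF.coeFn_toLp, Lp.coeFn_compMeasurePreserving (hF.toLp F) (hg h),
      (hg h).quasiMeasurePreserving.ae_eq_comp hF.coeFn_toLp] with x h1 h2 h3
    rw [h1, h2, h3, RCLike.inner_apply, mul_comm]
    rfl
  rw [this]
  exact continuous_const.inner hc

theorem tendsto_setIntegral_conj_mul_fourierIntegral (hϖ : IsPrimeElement ϖ)
    (hμ : μ (𝒪[K] : Set K) = 1) (hχ : IsBaseCharacter ϖ χ) {F : K → ℂ} (hF : MemLp F 1 μ)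
    (hF2 : MemLp F 2 μ) :
    Tendsto (fun n : ℕ => ∫ ξ in (fracIdeal ϖ (-(n : ℤ)) : Set K),
      conj (Fourier.fourierIntegral χ μ F ξ) * Fourier.fourierIntegral χ μ F ξ ∂μ) atTop
      (𝓝 (∫ x, conj (F x) * F x ∂μ)) := by
  have hc := continuous_autocorrelation hF2
  set R : K → ℂ := fun h => ∫ x, conj (F x) * F (x + h) ∂μ with hR
  have hR0 : ∫ x, conj (F x) * F x ∂μ = R 0 := by simp [hR]
  rw [hR0, Metric.tendsto_atTop]
  intro δ hδ
  have hnhds : R ⁻¹' Metric.ball (R 0) (δ / 2) ∈ 𝓝 0 :=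
    hc.continuousAt.preimage_mem_nhds (Metric.ball_mem_nhds _ (by positivity))
  obtain ⟨N, -, hN⟩ := (hasBasis_nhds_zero_fracIdeal hϖ).mem_iff.1 hnhds
  refine ⟨N, fun n hn => ?_⟩
  rw [setIntegral_conj_mul_fourierIntegral hϖ hχ (memLp_one_iff_integrable.1 hF)]
  have hmul := measureReal_fracIdeal_mul hϖ hμ n
  set m := μ.real (fracIdeal ϖ (-(n : ℤ)) : Set K)
  have hm0 : 0 ≤ m := measureReal_nonneg
  have hB := measure_fracIdeal_lt_top (μ := μ) (ϖ := ϖ) n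
  -- Since `m` is the inverse of the measure of `ϖ^n 𝒪`, the value `R 0` is its own average there.
  have e : (m : ℂ) * (∫ h in (fracIdeal ϖ (n : ℤ) : Set K), R h ∂μ) - R 0 =
      m * ∫ h in (fracIdeal ϖ (n : ℤ) : Set K), (R h - R 0) ∂μ := by
    rw [integral_sub (hc.continuousOn.integrableOn_compact' (isCompact_fracIdeal _)
      (measurableSet_fracIdeal hϖ _)) (integrableOn_const hB.ne (by simp)), setIntegral_const, mul_sub, Complex.real_smul, ← mul_assoc,
      ← Complex.ofReal_mul, hmul, Complex.ofReal_one, one_mul]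
  rw [dist_eq_norm, e, norm_mul, Complex.norm_real, Real.norm_of_nonneg hm0]
  have hle : ‖∫ h in (fracIdeal ϖ (n : ℤ) : Set K), (R h - R 0) ∂μ‖ ≤
      δ / 2 * μ.real (fracIdeal ϖ (n : ℤ) : Set K) := by
    refine norm_setIntegral_le_of_norm_le_const hB fun h hh => ?_
    have := hN (fracIdeal_anti hϖ (Int.ofNat_le.2 hn) hh)
    rw [Set.mem_preimage, Metric.mem_ball, dist_eq_norm] at this
    exact this.le
  calc m * _ ≤ m * (δ / 2 * μ.real (fracIdeal ϖ (n : ℤ) : Set K)) := by gcongr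
    _ = δ / 2 * (m * μ.real (fracIdeal ϖ (n : ℤ) : Set K)) := by ring
    _ < δ := by rw [hmul]; linarith

/-- Plancherel's theorem on `L¹ ∩ L²`. -/
theorem eLpNorm_fourierIntegral (hϖ : IsPrimeElement ϖ) (hμ : μ (𝒪[K] : Set K) = 1)
    (hχ : IsBaseCharacter ϖ χ) {F : K → ℂ} (hF : MemLp F 1 μ) (hF2 : MemLp F 2 μ) :
    eLpNorm (Fourier.fourierIntegral χ μ F) 2 μ = eLpNorm F 2 μ := by
  have hnorm : ∀ z : ℂ, conj z * z = ((‖z‖ ^ 2 : ℝ) : ℂ) := fun z => by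
    rw [← Complex.normSq_eq_conj_mul_self, Complex.normSq_eq_norm_sq]
  have hen : ∀ z : ℂ, ‖z‖ₑ ^ (2 : ℝ) = ENNReal.ofReal (‖z‖ ^ 2) := fun z => by
    rw [ENNReal.ofReal_pow (norm_nonneg _), ofReal_norm, ENNReal.rpow_two]
  set G := Fourier.fourierIntegral χ μ F
  have hG : Continuous G :=
    continuous_fourierIntegral hχ.continuous (memLp_one_iff_integrable.1 hF)
  have key : ∫⁻ ξ, ‖G ξ‖ₑ ^ (2 : ℝ) ∂μ = ∫⁻ x, ‖F x‖ₑ ^ (2 : ℝ) ∂μ := by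
    have h1 : Tendsto (fun n : ℕ => ∫⁻ ξ in (fracIdeal ϖ (-(n : ℤ)) : Set K), ‖G ξ‖ₑ ^ (2 : ℝ) ∂μ)
        atTop (𝓝 (∫⁻ ξ, ‖G ξ‖ₑ ^ (2 : ℝ) ∂μ)) := by
      have hmono : Monotone fun n : ℕ => (fracIdeal ϖ (-(n : ℤ)) : Set K) :=
        fun a b h => fracIdeal_anti hϖ (by omega)
      have := setLIntegral_iUnion_of_directed (μ := μ) (fun ξ => ‖G ξ‖ₑ ^ (2 : ℝ))
        hmono.directed_le
      rw [iUnion_fracIdeal hϖ, Measure.restrict_univ] at this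
      rw [this]
      exact tendsto_atTop_iSup fun a b h => lintegral_mono_set (hmono h)
    have h2 := tendsto_setIntegral_conj_mul_fourierIntegral hϖ hμ hχ hF hF2
    simp_rw [hnorm, integral_complex_ofReal] at h2
    have h3 := ENNReal.tendsto_ofReal ((Complex.continuous_re.tendsto _).comp h2)
    simp only [Function.comp_def, Complex.ofReal_re] at h3
    have hi : ∀ n : ℕ, IntegrableOn (fun ξ => ‖G ξ‖ ^ 2) (fracIdeal ϖ (-(n : ℤ)) : Set K) μ :=
      fun n => (hG.norm.pow 2).continuousOn.integrableOn_compact' (isCompact_fracIdeal _)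
        (measurableSet_fracIdeal hϖ _)
    have h4 : ∀ n : ℕ, ENNReal.ofReal (∫ ξ in (fracIdeal ϖ (-(n : ℤ)) : Set K), ‖G ξ‖ ^ 2 ∂μ) =
        ∫⁻ ξ in (fracIdeal ϖ (-(n : ℤ)) : Set K), ‖G ξ‖ₑ ^ (2 : ℝ) ∂μ := fun n => by
      rw [ofReal_integral_eq_lintegral_ofReal (hi n) (Eventually.of_forall fun _ => by positivity)]
      simp_rw [hen]
    have h5 : ENNReal.ofReal (∫ x, ‖F x‖ ^ 2 ∂μ) = ∫⁻ x, ‖F x‖ₑ ^ (2 : ℝ) ∂μ := by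
      rw [ofReal_integral_eq_lintegral_ofReal (hF2.integrable_norm_pow (by simp))
        (Eventually.of_forall fun _ => by positivity)]
      simp_rw [hen]
    rw [h5] at h3
    refine tendsto_nhds_unique h1 (h3.congr fun n => ?_)
    exact h4 n
  rw [eLpNorm_eq_lintegral_rpow_enorm_toReal (by simp) (by simp),
    eLpNorm_eq_lintegral_rpow_enorm_toReal (by simp) (by simp)]
  simp only [ENNReal.toReal_ofNat]
  rw [key]

end Plancherel

/-! ### The Fourier transform on `L²`, and its behaviour under translation and dilation. -/

section FourierL2

variable {K : Type*} [Field K] [ValuativeRel K] [TopologicalSpace K] [IsNonarchimedeanLocalField K]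
  [MeasurableSpace K] [BorelSpace K] [SecondCountableTopology K]
  {μ : Measure K} [μ.IsAddHaarMeasure] {ϖ : K} {χ : AddChar K Circle}

theorem memLp_fourierIntegral (hϖ : IsPrimeElement ϖ) (hμ : μ (𝒪[K] : Set K) = 1)
    (hχ : IsBaseCharacter ϖ χ) {F : K → ℂ} (hF : MemLp F 1 μ) (hF2 : MemLp F 2 μ) :
    MemLp (Fourier.fourierIntegral χ μ F) 2 μ :=
  ⟨(continuous_fourierIntegral hχ.continuous
    (memLp_one_iff_integrable.1 hF)).aestronglyMeasurable, by
    rw [eLpNorm_fourierIntegral hϖ hμ hχ hF hF2]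
    exact hF2.2⟩

theorem fourierIntegral_add_smul (hc : Continuous χ) {F G : K → ℂ} (hF : Integrable F μ)
    (hG : Integrable G μ) (c : ℂ) :
    Fourier.fourierIntegral χ μ (F + c • G) =
      Fourier.fourierIntegral χ μ F + c • Fourier.fourierIntegral χ μ G := by
  have hi : ∀ {H : K → ℂ} (ξ : K), Integrable H μ → Integrable (fun x => χ (-(x * ξ)) • H x) μ :=
    fun ξ hH => (VectorFourier.fourierIntegral_convergent_iff hc (L := LinearMap.mul K K)
      (by simpa using continuous_mul) ξ).2 hH
  ext ξ
  simp only [Pi.add_apply, Pi.smul_apply, Fourier.fourierIntegral_def]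
  rw [← integral_smul, ← integral_add (hi ξ hF) (show Integrable (fun x => c • χ (-(x * ξ)) • G x) μ from
    (hi ξ hG).smul c)]
  refine integral_congr_ae (Eventually.of_forall fun x => ?_)
  simp only [smul_add, smul_comm c]

theorem IsFourierTransform.congr {f f' g g' : K → ℂ} (h : IsFourierTransform χ μ f g)
    (hf : f =ᵐ[μ] f') (hg : g =ᵐ[μ] g') : IsFourierTransform χ μ f' g' := by
  obtain ⟨h1, h2, F, hF, hFf, hFg⟩ := h
  refine ⟨h1.ae_eq hf, h2.ae_eq hg, F, hF, hFf.congr fun n => ?_, hFg.congr fun n => ?_⟩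
  · exact eLpNorm_congr_ae (EventuallyEq.rfl.sub hf)
  · exact eLpNorm_congr_ae (EventuallyEq.rfl.sub hg)

theorem tendsto_eLpNorm_add_smul {F G : ℕ → K → ℂ} {f g : K → ℂ} (c : ℂ)
    (hF : ∀ n, MemLp (F n) 2 μ) (hG : ∀ n, MemLp (G n) 2 μ) (hf : MemLp f 2 μ) (hg : MemLp g 2 μ)
    (h1 : Tendsto (fun n => eLpNorm (F n - f) 2 μ) atTop (𝓝 0))
    (h2 : Tendsto (fun n => eLpNorm (G n - g) 2 μ) atTop (𝓝 0)) :
    Tendsto (fun n => eLpNorm (F n + c • G n - (f + c • g)) 2 μ) atTop (𝓝 0) := by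
  rw [← Lp.tendsto_Lp_iff_tendsto_eLpNorm'' F hF f hf] at h1
  rw [← Lp.tendsto_Lp_iff_tendsto_eLpNorm'' G hG g hg] at h2
  rw [← Lp.tendsto_Lp_iff_tendsto_eLpNorm'' (fun n => F n + c • G n)
    (fun n => (hF n).add ((hG n).const_smul c)) _ (hf.add (hg.const_smul c))]
  exact h1.add (h2.const_smul c)

theorem IsFourierTransform.add_smul (hϖ : IsPrimeElement ϖ) (hμ : μ (𝒪[K] : Set K) = 1)
    (hχ : IsBaseCharacter ϖ χ) {f f' g g' : K → ℂ} (h : IsFourierTransform χ μ f g)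
    (h' : IsFourierTransform χ μ f' g') (c : ℂ) :
    IsFourierTransform χ μ (f + c • f') (g + c • g') := by
  obtain ⟨h1, h2, F, hF, hFf, hFg⟩ := h
  obtain ⟨h1', h2', F', hF', hFf', hFg'⟩ := h'
  refine ⟨h1.add (h1'.const_smul c), h2.add (h2'.const_smul c), fun n => F n + c • F' n,
    fun n => ⟨(hF n).1.add ((hF' n).1.const_smul c), (hF n).2.add ((hF' n).2.const_smul c)⟩,
    tendsto_eLpNorm_add_smul c (fun n => (hF n).2) (fun n => (hF' n).2) h1 h1' hFf hFf', ?_⟩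
  simp_rw [fun n => fourierIntegral_add_smul hχ.continuous
    (memLp_one_iff_integrable.1 (hF n).1) (memLp_one_iff_integrable.1 (hF' n).1) c]
  exact tendsto_eLpNorm_add_smul c (fun n => memLp_fourierIntegral hϖ hμ hχ (hF n).1 (hF n).2)
    (fun n => memLp_fourierIntegral hϖ hμ hχ (hF' n).1 (hF' n).2) h2 h2' hFg hFg'

theorem IsFourierTransform.norm_eq (hϖ : IsPrimeElement ϖ) (hμ : μ (𝒪[K] : Set K) = 1)
    (hχ : IsBaseCharacter ϖ χ) {f g : Lp ℂ 2 μ} (h : IsFourierTransform χ μ f g) :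
    ‖g‖ = ‖f‖ := by
  obtain ⟨h1, h2, F, hF, hFf, hFg⟩ := h
  rw [← Lp.tendsto_Lp_iff_tendsto_eLpNorm'' F (fun n => (hF n).2) f h1] at hFf
  rw [← Lp.tendsto_Lp_iff_tendsto_eLpNorm'' _
    (fun n => memLp_fourierIntegral hϖ hμ hχ (hF n).1 (hF n).2) g h2] at hFg
  rw [Lp.toLp_coeFn] at hFf hFg
  refine tendsto_nhds_unique hFg.norm (hFf.norm.congr fun n => ?_)
  rw [Lp.norm_toLp, Lp.norm_toLp, eLpNorm_fourierIntegral hϖ hμ hχ (hF n).1 (hF n).2]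

theorem isFourierTransform_fourierIntegral (hϖ : IsPrimeElement ϖ) (hμ : μ (𝒪[K] : Set K) = 1)
    (hχ : IsBaseCharacter ϖ χ) {F : K → ℂ} (hF : MemLp F 1 μ) (hF2 : MemLp F 2 μ) :
    IsFourierTransform χ μ F (Fourier.fourierIntegral χ μ F) :=
  ⟨hF2, memLp_fourierIntegral hϖ hμ hχ hF hF2, fun _ => F, fun _ => ⟨hF, hF2⟩, by simp, by simp⟩

/-- Approximate by integrable simple functions; by Plancherel their transforms are again Cauchy, and
`L²` is complete. -/
theorem exists_isFourierTransform (hϖ : IsPrimeElement ϖ) (hμ : μ (𝒪[K] : Set K) = 1)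
    (hχ : IsBaseCharacter ϖ χ) (f : Lp ℂ 2 μ) : ∃ g : Lp ℂ 2 μ, IsFourierTransform χ μ f g := by
  have hf := Lp.memLp f
  have hex : ∀ n : ℕ, ∃ F : K → ℂ, (MemLp F 1 μ ∧ MemLp F 2 μ) ∧
      eLpNorm (F - (f : K → ℂ)) 2 μ ≤ (n + 1 : ℝ≥0∞)⁻¹ := fun n => by
    obtain ⟨F, hF, hF2⟩ := hf.exists_simpleFunc_eLpNorm_sub_lt (by simp)
      (ε := (n + 1 : ℝ≥0∞)⁻¹) (by simp)
    refine ⟨F, ⟨?_, hF2⟩, ?_⟩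
    · exact memLp_one_iff_integrable.2
        ((SimpleFunc.memLp_iff_integrable (by simp) (by simp)).1 hF2)
    · rw [eLpNorm_sub_comm]
      exact hF.le
  choose F hF hlim using hex
  have h0 : Tendsto (fun n => eLpNorm (F n - (f : K → ℂ)) 2 μ) atTop (𝓝 0) := by
    refine tendsto_of_tendsto_of_tendsto_of_le_of_le tendsto_const_nhds ?_ (fun _ => zero_le) hlim
    have := (tendsto_add_atTop_iff_nat 1).2 ENNReal.tendsto_inv_nat_nhds_zero
    simpa using this
  have hG := fun n => memLp_fourierIntegral hϖ hμ hχ (hF n).1 (hF n).2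
  have hc : CauchySeq fun n => (hF n).2.toLp (F n) :=
    ((Lp.tendsto_Lp_iff_tendsto_eLpNorm'' F (fun n => (hF n).2) f hf).2 h0).cauchySeq
  have hd : ∀ m n, dist ((hG m).toLp _) ((hG n).toLp _) =
      dist ((hF m).2.toLp (F m)) ((hF n).2.toLp (F n)) := fun m n => by
    have e : Fourier.fourierIntegral χ μ (F m) - Fourier.fourierIntegral χ μ (F n) =
        Fourier.fourierIntegral χ μ (F m - F n) := by
      have := fourierIntegral_add_smul hχ.continuous
        (memLp_one_iff_integrable.1 (hF m).1) (memLp_one_iff_integrable.1 (hF n).1) (-1)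
      rw [neg_one_smul, neg_one_smul, ← sub_eq_add_neg, ← sub_eq_add_neg] at this
      exact this.symm
    rw [dist_eq_norm, dist_eq_norm, ← MemLp.toLp_sub, ← MemLp.toLp_sub, Lp.norm_toLp,
      Lp.norm_toLp, e, eLpNorm_fourierIntegral hϖ hμ hχ ((hF m).1.sub (hF n).1)
      ((hF m).2.sub (hF n).2)]
  have hc' : CauchySeq fun n => (hG n).toLp _ := by
    rw [Metric.cauchySeq_iff] at hc ⊢
    simpa only [hd] using hc
  obtain ⟨g, hg⟩ := cauchySeq_tendsto_of_complete hc'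
  refine ⟨g, hf, Lp.memLp g, F, hF, h0, ?_⟩
  rw [← Lp.tendsto_Lp_iff_tendsto_eLpNorm'' _ hG g (Lp.memLp g), Lp.toLp_coeFn]
  exact hg

theorem IsFourierTransform.unique (hϖ : IsPrimeElement ϖ) (hμ : μ (𝒪[K] : Set K) = 1)
    (hχ : IsBaseCharacter ϖ χ) {f g g' : Lp ℂ 2 μ} (h : IsFourierTransform χ μ f g)
    (h' : IsFourierTransform χ μ f g') : g = g' := by
  have hd := h.add_smul hϖ hμ hχ h' (-1)
  have hd' : IsFourierTransform χ μ (f - f : Lp ℂ 2 μ) (g - g' : Lp ℂ 2 μ) := by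
    refine hd.congr ?_ ?_
    · filter_upwards [Lp.coeFn_sub f f] with x hx
      rw [hx]
      simp
    · filter_upwards [Lp.coeFn_sub g g'] with x hx
      rw [hx]
      simp [sub_eq_add_neg]
  have := hd'.norm_eq hϖ hμ hχ
  rwa [sub_self, norm_zero, norm_eq_zero, sub_eq_zero] at this

/-- The Fourier transform as a linear isometry of `L²(K)`. -/
noncomputable def fourierL2 (hϖ : IsPrimeElement ϖ) (hμ : μ (𝒪[K] : Set K) = 1)
    (hχ : IsBaseCharacter ϖ χ) : Lp ℂ 2 μ →ₗᵢ[ℂ] Lp ℂ 2 μ where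
  toFun f := (exists_isFourierTransform hϖ hμ hχ f).choose
  map_add' f g := by
    have hf := (exists_isFourierTransform hϖ hμ hχ f).choose_spec
    have hg := (exists_isFourierTransform hϖ hμ hχ g).choose_spec
    refine (exists_isFourierTransform hϖ hμ hχ (f + g)).choose_spec.unique hϖ hμ hχ ?_
    refine (hf.add_smul hϖ hμ hχ hg 1).congr ?_ ?_
    · rw [one_smul]
      exact (Lp.coeFn_add _ _).symm
    · rw [one_smul]
      exact (Lp.coeFn_add _ _).symm
  map_smul' c f := by
    have hf := (exists_isFourierTransform hϖ hμ hχ f).choose_spec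
    -- Subtracting the pair from itself gives the zero pair, so that `add_smul` also yields plain
    -- scalar multiples.
    have h0 : IsFourierTransform χ μ (0 : K → ℂ) (0 : K → ℂ) :=
      (hf.add_smul hϖ hμ hχ hf (-1)).congr (by simp) (by simp)
    refine (exists_isFourierTransform hϖ hμ hχ (c • f)).choose_spec.unique hϖ hμ hχ ?_
    refine (h0.add_smul hϖ hμ hχ hf c).congr ?_ ?_
    · rw [zero_add]
      exact (Lp.coeFn_smul _ _).symm
    · rw [zero_add]
      exact (Lp.coeFn_smul _ _).symm
  norm_map' f := (exists_isFourierTransform hϖ hμ hχ f).choose_spec.norm_eq hϖ hμ hχ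

theorem isFourierTransform_fourierL2 (hϖ : IsPrimeElement ϖ) (hμ : μ (𝒪[K] : Set K) = 1)
    (hχ : IsBaseCharacter ϖ χ) (f : Lp ℂ 2 μ) :
    IsFourierTransform χ μ f (fourierL2 hϖ hμ hχ f) :=
  (exists_isFourierTransform hϖ hμ hχ f).choose_spec

theorem IsFourierTransform.fourierL2_ae_eq (hϖ : IsPrimeElement ϖ) (hμ : μ (𝒪[K] : Set K) = 1)
    (hχ : IsBaseCharacter ϖ χ) {f : Lp ℂ 2 μ} {f' g : K → ℂ} (h : IsFourierTransform χ μ f' g)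
    (hf : f =ᵐ[μ] f') : fourierL2 hϖ hμ hχ f =ᵐ[μ] g := by
  have hg := h.2.1
  have := (isFourierTransform_fourierL2 hϖ hμ hχ f).unique hϖ hμ hχ
    (h.congr hf.symm hg.coeFn_toLp.symm)
  rw [this]
  exact hg.coeFn_toLp

theorem IsFourierTransform.translate (hc : Continuous χ) {f g : K → ℂ}
    (h : IsFourierTransform χ μ f g) (a : K) :
    IsFourierTransform χ μ (fun x => f (x - a)) (fun ξ => χ (-(a * ξ)) * g ξ) := by
  obtain ⟨h1, h2, F, hF, hFf, hFg⟩ := h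
  have hp := measurePreserving_sub_right μ a
  have hm : AEStronglyMeasurable (fun ξ => (χ (-(a * ξ)) : ℂ)) μ :=
    (continuous_subtype_val.comp (hc.comp (by fun_prop : Continuous fun ξ => -(a * ξ)))
      ).aestronglyMeasurable
  have hn : ∀ G : K → ℂ, eLpNorm (fun ξ => χ (-(a * ξ)) * G ξ) 2 μ = eLpNorm G 2 μ := fun G =>
    eLpNorm_congr_norm_ae (Eventually.of_forall fun ξ => by
      rw [norm_mul, Circle.norm_coe, one_mul])
  refine ⟨h1.comp_measurePreserving hp, ⟨hm.mul h2.1, by rw [hn]; exact h2.2⟩,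
    fun n x => F n (x - a), fun n => ⟨(hF n).1.comp_measurePreserving hp,
      (hF n).2.comp_measurePreserving hp⟩, hFf.congr fun n => ?_, hFg.congr fun n => ?_⟩
  · exact (eLpNorm_comp_measurePreserving ((hF n).2.sub h1).1 hp).symm
  · rw [← hn]
    congr 1
    ext ξ
    simp only [Pi.sub_apply, Fourier.fourierIntegral_def, mul_sub]
    congr 1
    rw [← integral_const_mul, ← integral_sub_right_eq_self _ a]
    refine integral_congr_ae (Eventually.of_forall fun x => ?_)
    have : -(x * ξ) = -(a * ξ) + -((x - a) * ξ) := by ring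
    simp only [this, AddChar.map_add_eq_mul, Circle.smul_def, Circle.coe_mul, smul_eq_mul, mul_assoc]

theorem exists_map_mul_left_eq_smul (μ : Measure K) [μ.IsAddHaarMeasure] {b : K} (hb : b ≠ 0) :
    ∃ C : NNReal, C ≠ 0 ∧ μ.map (b * ·) = (C : ℝ≥0∞) • μ := by
  refine ⟨distribHaarChar K (Units.mk0 b hb)⁻¹, distribHaarChar_pos.ne', ?_⟩
  ext s hs
  rw [Measure.map_apply (measurable_const_mul b) hs, Measure.smul_apply, smul_eq_mul,
    ← measure_smul_eq μ, Units.val_inv_eq_inv_val, Units.val_mk0]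
  congr 1
  ext x
  rw [Set.mem_smul_set_iff_inv_smul_mem₀ (inv_ne_zero hb), inv_inv]
  rfl

theorem quasiMeasurePreserving_mul_left (μ : Measure K) [μ.IsAddHaarMeasure] {b : K} (hb : b ≠ 0) :
    Measure.QuasiMeasurePreserving (b * ·) μ μ := by
  obtain ⟨C, -, hC⟩ := exists_map_mul_left_eq_smul μ hb
  exact ⟨measurable_const_mul b, hC ▸ Measure.smul_absolutelyContinuous⟩

theorem MemLp.comp_mul_left {q : ℝ≥0∞} {f : K → ℂ} (hf : MemLp f q μ) {b : K} (hb : b ≠ 0) :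
    MemLp (fun x => f (b * x)) q μ := by
  obtain ⟨C, -, hC⟩ := exists_map_mul_left_eq_smul μ hb
  refine (Homeomorph.mulLeft₀ b hb).measurableEmbedding.memLp_map_measure_iff.1 ?_
  have := hf.smul_measure (c := C) ENNReal.coe_ne_top
  rw [← hC] at this
  exact this

theorem tendsto_eLpNorm_comp_mul_left {G : ℕ → K → ℂ}
    (hG : Tendsto (fun n => eLpNorm (G n) 2 μ) atTop (𝓝 0)) {b : K} (hb : b ≠ 0) :
    Tendsto (fun n => eLpNorm (fun x => G n (b * x)) 2 μ) atTop (𝓝 0) := by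
  obtain ⟨C, -, hC⟩ := exists_map_mul_left_eq_smul μ hb
  have e : ∀ n, eLpNorm (fun x => G n (b * x)) 2 μ =
      (C : ℝ≥0∞) ^ (1 / (2 : ℝ≥0∞)).toReal * eLpNorm (G n) 2 μ := fun n => by
    rw [← smul_eq_mul, ← eLpNorm_smul_measure_of_ne_top (by simp), ← hC]
    exact ((Homeomorph.mulLeft₀ b hb).measurableEmbedding.eLpNorm_map_measure).symm
  simp_rw [e]
  have := ENNReal.Tendsto.const_mul (a := (C : ℝ≥0∞) ^ (1 / (2 : ℝ≥0∞)).toReal) hG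
    (Or.inr (ENNReal.rpow_ne_top_of_nonneg (by simp) ENNReal.coe_ne_top))
  rwa [mul_zero] at this

theorem fourierIntegral_comp_mul_left {b : K} (hb : b ≠ 0) {C : NNReal}
    (hC : μ.map (b * ·) = (C : ℝ≥0∞) • μ) (F : K → ℂ) (ξ : K) :
    Fourier.fourierIntegral χ μ (fun x => F (b * x)) ξ =
      (C : ℝ) * Fourier.fourierIntegral χ μ F (b⁻¹ * ξ) := by
  have e := (Homeomorph.mulLeft₀ b hb).measurableEmbedding.integral_map (μ := μ)
    (fun y => χ (-(y * (b⁻¹ * ξ))) • F y)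
  rw [Fourier.fourierIntegral_def, Fourier.fourierIntegral_def]
  calc _ = ∫ x, χ (-(b * x * (b⁻¹ * ξ))) • F (b * x) ∂μ := by
        refine integral_congr_ae (Eventually.of_forall fun x => ?_)
        have : b * x * (b⁻¹ * ξ) = x * ξ := by field_simp
        simp only [this]
    _ = ∫ y, χ (-(y * (b⁻¹ * ξ))) • F y ∂(μ.map (b * ·)) := e.symm
    _ = _ := by rw [hC, integral_smul_measure, ENNReal.coe_toReal, Complex.real_smul]

theorem IsFourierTransform.dilate {f g : K → ℂ} (h : IsFourierTransform χ μ f g) {b : K}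
    (hb : b ≠ 0) : ∃ C : ℂ, C ≠ 0 ∧
      IsFourierTransform χ μ (fun x => f (b * x)) (fun ξ => C * g (b⁻¹ * ξ)) := by
  obtain ⟨h1, h2, F, hF, hFf, hFg⟩ := h
  obtain ⟨C, hC0, hC⟩ := exists_map_mul_left_eq_smul μ hb
  refine ⟨(C : ℝ), by simpa using hC0, MemLp.comp_mul_left h1 hb,
    (MemLp.comp_mul_left h2 (inv_ne_zero hb)).const_mul _, fun n x => F n (b * x),
    fun n => ⟨MemLp.comp_mul_left (hF n).1 hb, MemLp.comp_mul_left (hF n).2 hb⟩,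
    tendsto_eLpNorm_comp_mul_left hFf hb, ?_⟩
  have hlim := ENNReal.Tendsto.const_mul (a := ‖((C : ℝ) : ℂ)‖ₑ)
    (tendsto_eLpNorm_comp_mul_left hFg (inv_ne_zero hb)) (Or.inr enorm_ne_top)
  rw [mul_zero] at hlim
  refine hlim.congr fun n => ?_
  rw [← eLpNorm_const_smul]
  congr 1
  ext ξ
  simp only [Pi.sub_apply, Pi.smul_apply, fourierIntegral_comp_mul_left hb hC, smul_eq_mul, mul_sub]

end FourierL2

/-! ### Spectral supports of the spaces `V n`: monotonicity and exhaustion. -/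

section Support

variable {K : Type*} [Field K] [ValuativeRel K] [TopologicalSpace K] [IsNonarchimedeanLocalField K]
  [MeasurableSpace K] [BorelSpace K] [SecondCountableTopology K]
  {μ : Measure K} [μ.IsAddHaarMeasure] {ϖ : K} {χ : AddChar K Circle}

/-- The closed subspace of all `f ∈ L²(K)` whose Fourier transform vanishes on `A`. -/
noncomputable def spectrumVanishing (hϖ : IsPrimeElement ϖ) (hμ : μ (𝒪[K] : Set K) = 1)
    (hχ : IsBaseCharacter ϖ χ) (A : Set K) : Submodule ℂ (Lp ℂ 2 μ) :=
  ((LpToLpRestrictCLM K ℂ ℂ μ 2 A).comp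
    (fourierL2 hϖ hμ hχ).toContinuousLinearMap).ker

theorem isClosed_spectrumVanishing (hϖ : IsPrimeElement ϖ) (hμ : μ (𝒪[K] : Set K) = 1)
    (hχ : IsBaseCharacter ϖ χ) (A : Set K) :
    IsClosed (spectrumVanishing hϖ hμ hχ A : Set (Lp ℂ 2 μ)) :=
  ContinuousLinearMap.isClosed_ker _

theorem mem_spectrumVanishing (hϖ : IsPrimeElement ϖ) (hμ : μ (𝒪[K] : Set K) = 1)
    (hχ : IsBaseCharacter ϖ χ) {A : Set K} (hA : MeasurableSet A) {f : Lp ℂ 2 μ} :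
    f ∈ spectrumVanishing hϖ hμ hχ A ↔ ∀ᵐ ξ ∂μ, ξ ∈ A → fourierL2 hϖ hμ hχ f ξ = 0 := by
  rw [← ae_restrict_iff' hA, spectrumVanishing, LinearMap.mem_ker]
  have h := LpToLpRestrictCLM_coeFn (F := ℂ) (p := 2) (μ := μ) ℂ A (fourierL2 hϖ hμ hχ f)
  change LpToLpRestrictCLM K ℂ ℂ μ 2 A (fourierL2 hϖ hμ hχ f) = 0 ↔ _
  rw [Lp.eq_zero_iff_ae_eq_zero]
  exact ⟨fun h' => h.symm.trans h', fun h' => h.trans h'⟩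

theorem fourierL2_translate_ae_eq (hϖ : IsPrimeElement ϖ) (hμ : μ (𝒪[K] : Set K) = 1)
    (hχ : IsBaseCharacter ϖ χ) {φ : Lp ℂ 2 μ} {g : K → ℂ} (h : IsFourierTransform χ μ φ g)
    (a : K) : fourierL2 hϖ hμ hχ (translate μ a φ) =ᵐ[μ] fun ξ => χ (-(a * ξ)) * g ξ :=
  (h.translate hχ.continuous a).fourierL2_ae_eq hϖ hμ hχ
    (Lp.coeFn_compMeasurePreserving φ (measurePreserving_sub_right μ a))

theorem measurableSet_zpow_smul (hϖ : IsPrimeElement ϖ) {S : Set K} (hS : MeasurableSet S) (j : ℤ) :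
    MeasurableSet (ϖ ^ j • S) :=
  hS.const_smul_of_ne_zero (zpow_ne_zero _ hϖ.ne_zero)

theorem mem_zpow_smul_iff (hϖ : IsPrimeElement ϖ) {S : Set K} {j : ℤ} {x : K} :
    x ∈ ϖ ^ j • S ↔ ϖ ^ (-j) * x ∈ S := by
  rw [Set.mem_smul_set_iff_inv_smul_mem₀ (zpow_ne_zero _ hϖ.ne_zero), ← zpow_neg, smul_eq_mul]

theorem IsMRA.fourierL2_eq_zero {w : ℕ → K} {V : ℤ → Submodule ℂ (Lp ℂ 2 μ)} {φ : Lp ℂ 2 μ}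
    (hV : IsMRA μ ϖ w V φ) (hϖ : IsPrimeElement ϖ) (hμ : μ (𝒪[K] : Set K) = 1)
    (hχ : IsBaseCharacter ϖ χ) {S : Set K} (hS : MeasurableSet S)
    (hφ : IsFourierTransform χ μ φ (S.indicator fun _ => (1 : ℂ))) (n : ℕ) :
    ∀ f ∈ V n, ∀ᵐ ξ ∂μ, ξ ∉ ϖ ^ (-(n : ℤ)) • S → fourierL2 hϖ hμ hχ f ξ = 0 := by
  induction n with
  | zero =>
    have hle : V 0 ≤ spectrumVanishing hϖ hμ hχ Sᶜ := by
      rw [← hV.span_eq]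
      refine Submodule.topologicalClosure_minimal _ ?_ (isClosed_spectrumVanishing hϖ hμ hχ _)
      rw [Submodule.span_le]
      rintro _ ⟨n, rfl⟩
      rw [SetLike.mem_coe, mem_spectrumVanishing hϖ hμ hχ hS.compl]
      filter_upwards [fourierL2_translate_ae_eq hϖ hμ hχ hφ (w n)] with ξ hξ h
      rw [hξ, Set.indicator_of_notMem h, mul_zero]
    intro f hf
    have := (mem_spectrumVanishing hϖ hμ hχ hS.compl).1 (hle (by simpa using hf))
    simpa using this
  | succ n ih =>
    intro f hf
    have h0 := hϖ.ne_zero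
    have hg := MemLp.comp_mul_left (Lp.memLp f) h0
    -- The dilation axiom is used backwards: `f` is the dilate of `g = f(ϖ ·)`, so `g` belongs to `V
    -- n`.
    have hfg : f =ᵐ[μ] fun x => hg.toLp _ (ϖ⁻¹ * x) := by
      have := (quasiMeasurePreserving_mul_left μ (inv_ne_zero h0)).ae_eq_comp hg.coeFn_toLp
      filter_upwards [this] with x hx
      simp only [Function.comp_apply] at hx
      rw [hx, mul_inv_cancel_left₀ h0]
    have hgV : hg.toLp _ ∈ V n := (hV.dilation n _ f hfg).2 (by exact_mod_cast hf)
    obtain ⟨C, -, hC⟩ := (isFourierTransform_fourierL2 hϖ hμ hχ (hg.toLp _)).dilate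
      (inv_ne_zero h0)
    have hzero := (quasiMeasurePreserving_mul_left μ h0).ae (ih _ hgV)
    filter_upwards [hC.fourierL2_ae_eq hϖ hμ hχ hfg, hzero] with ξ h1 h2 hξ
    rw [h1, inv_inv, h2, mul_zero]
    rw [mem_zpow_smul_iff hϖ] at hξ ⊢
    rw [← mul_assoc, ← zpow_add_one₀ h0]
    have e : -(-((n + 1 : ℕ) : ℤ)) = -(-(n : ℤ)) + 1 := by
      push_cast
      ring
    rwa [e] at hξ

theorem IsMRA.ae_le_smul {w : ℕ → K} {V : ℤ → Submodule ℂ (Lp ℂ 2 μ)} {φ : Lp ℂ 2 μ}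
    (hV : IsMRA μ ϖ w V φ) (hϖ : IsPrimeElement ϖ) (hμ : μ (𝒪[K] : Set K) = 1)
    (hχ : IsBaseCharacter ϖ χ) {S : Set K} (hS : MeasurableSet S)
    (hφ : IsFourierTransform χ μ φ (S.indicator fun _ => (1 : ℂ))) (j : ℤ) :
    ∀ᵐ ξ ∂μ, ξ ∈ ϖ ^ (-j) • S → ξ ∈ ϖ ^ (-(j + 1)) • S := by
  have hmem : translate μ (w 0) φ ∈ V (1 : ℕ) := by
    have h0 : translate μ (w 0) φ ∈ V 0 := by
      rw [← hV.span_eq]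
      exact Submodule.le_topologicalClosure _ (Submodule.subset_span ⟨0, rfl⟩)
    simpa using hV.mono 0 h0
  have h1 : ∀ᵐ ξ ∂μ, ξ ∈ S → ξ ∈ ϖ ^ (-(1 : ℤ)) • S := by
    filter_upwards [hV.fourierL2_eq_zero hϖ hμ hχ hS hφ 1 _ hmem,
      fourierL2_translate_ae_eq hϖ hμ hχ hφ (w 0)] with ξ h1 h2 hξ
    by_contra hn
    have := h1 (by simpa using hn)
    rw [h2, Set.indicator_of_mem hξ, mul_one] at this
    exact Circle.coe_ne_zero _ this
  -- Multiplication by `ϖ^j` preserves null sets, so the inclusion at level `0` gives every level.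
  filter_upwards [(quasiMeasurePreserving_mul_left μ (zpow_ne_zero j hϖ.ne_zero)).ae h1] with ξ h
  rw [mem_zpow_smul_iff hϖ, mem_zpow_smul_iff hϖ] at *
  rw [← mul_assoc, ← zpow_add₀ hϖ.ne_zero, neg_neg] at h
  rwa [neg_neg, neg_neg, add_comm j 1]

theorem IsMRA.ae_exists_mem_smul {w : ℕ → K} {V : ℤ → Submodule ℂ (Lp ℂ 2 μ)} {φ : Lp ℂ 2 μ}
    (hV : IsMRA μ ϖ w V φ) (hϖ : IsPrimeElement ϖ) (hμ : μ (𝒪[K] : Set K) = 1)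
    (hχ : IsBaseCharacter ϖ χ) {S : Set K} (hS : MeasurableSet S)
    (hφ : IsFourierTransform χ μ φ (S.indicator fun _ => (1 : ℂ))) :
    ∀ᵐ ξ ∂μ, ∃ n : ℕ, ξ ∈ ϖ ^ (-(n : ℤ)) • S := by
  set A : Set K := (⋃ n : ℕ, ϖ ^ (-(n : ℤ)) • S)ᶜ with hA
  have hAm : MeasurableSet A :=
    (MeasurableSet.iUnion fun n : ℕ => measurableSet_zpow_smul hϖ hS _).compl
  have hmono : Monotone V := monotone_int_of_le_succ hV.mono
  have hVA : ∀ j, V j ≤ spectrumVanishing hϖ hμ hχ A := fun j f hf => by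
    rw [mem_spectrumVanishing hϖ hμ hχ hAm]
    filter_upwards [hV.fourierL2_eq_zero hϖ hμ hχ hS hφ j.toNat f
      (hmono (Int.self_le_toNat j) hf)] with ξ h hξ
    exact h fun hmem => hξ (Set.mem_iUnion_of_mem _ hmem)
  have htop : ∀ f, f ∈ spectrumVanishing hϖ hμ hχ A := fun f => by
    have hf : f ∈ closure (⋃ j, (V j : Set (Lp ℂ 2 μ))) := by
      rw [hV.dense]
      trivial
    exact closure_minimal (Set.iUnion_subset hVA) (isClosed_spectrumVanishing hϖ hμ hχ A) hf
  -- The test function is the indicator of `ϖ^n 𝒪`, whose transform is the constant `μ(ϖ^n 𝒪) ≠ 0`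
  -- on the dual ball `ϖ^(-n) 𝒪`.
  have hball : ∀ n : ℕ, ∀ᵐ ξ ∂μ, ξ ∈ fracIdeal ϖ (-(n : ℤ)) → ξ ∉ A := fun n => by
    set B : Set K := ↑(fracIdeal ϖ (n : ℤ))
    have hB : MeasurableSet B := measurableSet_fracIdeal hϖ _
    have hBt := (measure_fracIdeal_lt_top (μ := μ) (ϖ := ϖ) n).ne
    have hF : ∀ q : ℝ≥0∞, MemLp (B.indicator fun _ => (1 : ℂ)) q μ := fun q =>
      memLp_indicator_const q hB 1 (Or.inr hBt)
    have hpos : μ.real B ≠ 0 := fun h => by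
      simpa [B, h] using measureReal_fracIdeal_mul hϖ hμ n
    have h1 := (isFourierTransform_fourierIntegral hϖ hμ hχ (hF 1) (hF 2)).fourierL2_ae_eq
      hϖ hμ hχ (hF 2).coeFn_toLp
    filter_upwards [h1, (mem_spectrumVanishing hϖ hμ hχ hAm).1 (htop ((hF 2).toLp _))]
      with ξ h1 h2 hξ hξA
    have h3 : Fourier.fourierIntegral χ μ (B.indicator fun _ => (1 : ℂ)) ξ = μ.real B := by
      have h4 := setIntegral_char_fracIdeal (μ := μ) hϖ hχ (-(n : ℤ)) (-ξ)
      rw [neg_neg, Set.indicator_of_mem (SetLike.mem_coe.2 (neg_mem hξ)),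
        ← integral_indicator hB] at h4
      rw [Fourier.fourierIntegral_def, ← h4]
      refine integral_congr_ae (Eventually.of_forall fun x => ?_)
      by_cases hx : x ∈ B
      · simp [hx, Circle.smul_def, mul_comm]
      · simp [hx]
    rw [h1, h3] at h2
    exact hpos (Complex.ofReal_eq_zero.1 (h2 hξA))
  filter_upwards [ae_all_iff.2 hball] with ξ h
  obtain ⟨n, hn⟩ := exists_mem_fracIdeal hϖ ξ
  simpa [hA] using h n hn

end Support

/-! ### The self-dual lattice of translations and its base `q` enumeration. -/

section Lattice

variable {K : Type*} [Field K] [ValuativeRel K] [TopologicalSpace K] [IsNonarchimedeanLocalField K]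
  {p c : ℕ} {ϖ : K} {ε : Fin c → K} {χ : AddChar K Circle} {F : Subfield K}

theorem valuation_eq_one_of_mem_finite_subfield [Finite F] {a : K} (ha : a ∈ F) (h0 : a ≠ 0) :
    valuation K a = 1 := by
  have : Fintype F := Fintype.ofFinite F
  have h1 : (⟨a, ha⟩ : F) ^ (Fintype.card F - 1) = 1 :=
    FiniteField.pow_card_sub_one_eq_one _ fun h => h0 (congrArg Subtype.val h)
  have h2 : a ^ (Fintype.card F - 1) = 1 := congrArg Subtype.val h1
  have h3 : valuation K a ^ (Fintype.card F - 1) = 1 := by rw [← map_pow, h2, map_one]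
  exact (pow_eq_one_iff_of_nonneg zero_le
    (by have := Fintype.one_lt_card (α := F); omega)).1 h3

theorem subfield_le_integer [Finite F] {a : K} (ha : a ∈ F) : a ∈ 𝒪[K] := by
  rw [Valuation.mem_integer_iff]
  rcases eq_or_ne a 0 with rfl | h0
  · simp
  · exact (valuation_eq_one_of_mem_finite_subfield ha h0).le

/-- Reduction `F → 𝓀[K]` is an injective map between finite fields of equal size, so `F` is a full
set of residue representatives. -/
theorem exists_sub_mem_fracIdeal_one [Finite F] (hϖ : IsPrimeElement ϖ)
    (hF : Nat.card F = Nat.card 𝓀[K]) {x : K} (hx : x ∈ fracIdeal ϖ 0) :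
    ∃ a : F, x - a ∈ fracIdeal ϖ 1 := by
  let i : F →+* 𝒪[K] :=
    F.subtype.codRestrict 𝒪[K] fun a => subfield_le_integer a.2
  let r : F →+* 𝓀[K] := (IsLocalRing.residue 𝒪[K]).comp i
  have hr : Function.Surjective r := by
    have := Fintype.ofFinite F
    have := Fintype.ofFinite 𝓀[K]
    refine ((Fintype.bijective_iff_injective_and_card r).2 ⟨r.injective, ?_⟩).2
    rwa [← Nat.card_eq_fintype_card, ← Nat.card_eq_fintype_card]
  obtain ⟨a, ha⟩ := hr (IsLocalRing.residue 𝒪[K] ⟨x, mem_fracIdeal_zero.1 hx⟩)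
  refine ⟨a, ?_⟩
  have h1 : IsLocalRing.residue 𝒪[K] (⟨x, mem_fracIdeal_zero.1 hx⟩ - i a) = 0 := by
    rw [map_sub, ← ha]
    exact sub_self _
  rw [IsLocalRing.residue_eq_zero_iff, IsLocalRing.mem_maximalIdeal, mem_nonunits_iff,
    (Valuation.integer.integers (valuation K)).isUnit_iff_valuation_eq_one] at h1
  have h2 : valuation K (x - a) ≤ 1 :=
    Valuation.mem_integer_iff .. |>.1 ((⟨x, mem_fracIdeal_zero.1 hx⟩ : 𝒪[K]) - i a).2
  rw [mem_fracIdeal, zpow_one]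
  exact hϖ.2 _ (lt_of_le_of_ne h2 h1)

/-- The finite sums `∑ ϖ ^ (-(i + 1)) f i` with `i < k` and coefficients in `F`. -/
def latticeHom (ϖ : K) (F : Subfield K) (k : ℕ) : (Fin k → F) →+ K where
  toFun f := ∑ i : Fin k, ϖ ^ (-(((i : ℕ) : ℤ) + 1)) * (f i : K)
  map_zero' := by simp
  map_add' f g := by simp [mul_add, Finset.sum_add_distrib]

theorem latticeHom_apply (k : ℕ) (f : Fin k → F) :
    latticeHom ϖ F k f = ∑ i : Fin k, ϖ ^ (-(((i : ℕ) : ℤ) + 1)) * (f i : K) := rfl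

theorem latticeHom_mem_fracIdeal [Finite F] (hϖ : IsPrimeElement ϖ) (k : ℕ) (f : Fin k → F) :
    latticeHom ϖ F k f ∈ fracIdeal ϖ (-(k : ℤ)) := by
  rw [latticeHom_apply]
  refine sum_mem fun i _ => ?_
  rw [zpow_mul_mem_fracIdeal_iff hϖ]
  refine fracIdeal_anti hϖ ?_ (mem_fracIdeal_zero.2 (subfield_le_integer (f i).2))
  have := i.2
  omega

theorem exists_sub_latticeHom_mem [Finite F] (hϖ : IsPrimeElement ϖ)
    (hF : Nat.card F = Nat.card 𝓀[K]) (k : ℕ) {x : K} (hx : x ∈ fracIdeal ϖ (-(k : ℤ))) :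
    ∃ f : Fin k → F, x - latticeHom ϖ F k f ∈ fracIdeal ϖ 0 := by
  induction k generalizing x with
  | zero => exact ⟨0, by simpa [latticeHom_apply] using hx⟩
  | succ k ih =>
    have h0 := hϖ.ne_zero
    -- `a` is the leading digit of `x`, the coefficient of `ϖ^(-(k+1))`; removing it lowers the pole
    -- order.
    obtain ⟨a, ha⟩ := exists_sub_mem_fracIdeal_one hϖ hF (x := ϖ ^ ((k : ℤ) + 1) * x)
      ((zpow_mul_mem_fracIdeal_iff hϖ).2 (by simpa using hx))
    have h1 : x - ϖ ^ (-((k : ℤ) + 1)) * a ∈ fracIdeal ϖ (-(k : ℤ)) := by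
      have h2 := (zpow_mul_mem_fracIdeal_iff hϖ (m := -((k : ℤ) + 1)) (k := -(k : ℤ))).2
        (by simpa using ha)
      rwa [mul_sub, ← mul_assoc, ← zpow_add₀ h0, neg_add_cancel, zpow_zero, one_mul] at h2
    obtain ⟨f, hf⟩ := ih h1
    refine ⟨Fin.snoc f a, ?_⟩
    rw [latticeHom_apply] at hf ⊢
    rw [Fin.sum_univ_castSucc]
    simpa [sub_sub, add_comm] using hf

theorem addChar_sum_eq_one {A M ι : Type*} [AddCommMonoid A] [Monoid M] {ψ : AddChar A M}
    {s : Finset ι} {f : ι → A} (h : ∀ i ∈ s, ψ (f i) = 1) : ψ (∑ i ∈ s, f i) = 1 :=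
  Finset.sum_induction f (fun x => ψ x = 1)
    (fun a b ha hb => by rw [AddChar.map_add_eq_mul, ha, hb, one_mul]) (AddChar.map_zero_eq_one ψ) h

/-- `Λ` lies in its own annihilator: `F` is closed under products, and the terms `ϖ^(-(i+1)-(j+1))`
never reach the exponent `-1`, the only one where `χ` can be nontrivial on `F`. -/
theorem char_mul_latticeHom [NeZero c] (hϖ : IsPrimeElement ϖ)
    (hF : (F : Set K) = (AddSubgroup.closure (Set.range ε) : Set K))
    (hstd : HasStandardValues p ϖ ε χ) {k l : ℕ} (f : Fin k → F) (g : Fin l → F) :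
    χ (latticeHom ϖ F k f * latticeHom ϖ F l g) = 1 := by
  have key : ∀ j : ℤ, j ≠ 1 → ∀ a ∈ F, χ (a * ϖ ^ (-j)) = 1 := fun j hj a ha => by
    have ha' : a ∈ AddSubgroup.closure (Set.range ε) := by
      rw [← SetLike.mem_coe, ← hF]
      exact ha
    induction ha' using AddSubgroup.closure_induction with
    | mem x hx =>
      obtain ⟨i, rfl⟩ := hx
      rw [hstd, if_neg fun h => hj h.2]
    | zero => simp
    | add x y hx hy h1 h2 =>
      have hmem : ∀ {z}, z ∈ AddSubgroup.closure (Set.range ε) → z ∈ F := fun hz => by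
        rw [← SetLike.mem_coe, hF]
        exact hz
      rw [add_mul, AddChar.map_add_eq_mul, h1 (hmem hx), h2 (hmem hy), one_mul]
    | neg x hx h1 =>
      rw [neg_mul, AddChar.map_neg_eq_inv, h1 (by simpa using neg_mem ha), inv_one]
  rw [latticeHom_apply, latticeHom_apply, Finset.sum_mul_sum]
  refine addChar_sum_eq_one fun i _ => addChar_sum_eq_one fun j _ => ?_
  have := key ((i : ℤ) + 1 + ((j : ℤ) + 1)) (by omega) _ (mul_mem (f i).2 (g j).2)
  rw [← this, neg_add ((i : ℤ) + 1), zpow_add₀ hϖ.ne_zero]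
  congr 1
  ring

/-- An element of `Λ ∩ 𝒪` pairs trivially with `Λ` and with `𝒪`, hence with `Λ + 𝒪 = K`; only `0`
does so. -/
theorem latticeHom_eq_zero_of_mem_fracIdeal [NeZero c] [Finite F] (hϖ : IsPrimeElement ϖ)
    (hχ : IsBaseCharacter ϖ χ) (hcard : Nat.card F = Nat.card 𝓀[K])
    (hF : (F : Set K) = (AddSubgroup.closure (Set.range ε) : Set K))
    (hstd : HasStandardValues p ϖ ε χ) {k : ℕ} {f : Fin k → F}
    (hf : latticeHom ϖ F k f ∈ fracIdeal ϖ 0) : latticeHom ϖ F k f = 0 := by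
  by_contra hne
  obtain ⟨m, hm⟩ := hϖ.exists_eq_zpow hne
  have hnot : latticeHom ϖ F k f ∉ fracIdeal ϖ ((m + 1).toNat : ℤ) := by
    rw [mem_fracIdeal, hm, hϖ.zpow_le_zpow_iff]
    omega
  obtain ⟨y, hy, hy'⟩ := hχ.exists_ne_one hϖ hnot
  obtain ⟨g, hg⟩ := exists_sub_latticeHom_mem hϖ hcard _ hy
  refine hy' ?_
  have e : latticeHom ϖ F k f * y = latticeHom ϖ F k f * latticeHom ϖ F _ g +
      latticeHom ϖ F k f * (y - latticeHom ϖ F _ g) := by ring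
  rw [e, AddChar.map_add_eq_mul, char_mul_latticeHom hϖ hF hstd, one_mul]
  exact hχ.eq_one (by simpa using mul_mem_fracIdeal hϖ hf hg)

/-- The annihilator of `Λ ∩ ϖ ^ (-k) 𝒪` is `Λ + ϖ ^ k 𝒪`. -/
theorem forall_char_latticeHom_mul_eq_one_iff [NeZero c] [Finite F] (hϖ : IsPrimeElement ϖ)
    (hχ : IsBaseCharacter ϖ χ) (hcard : Nat.card F = Nat.card 𝓀[K])
    (hF : (F : Set K) = (AddSubgroup.closure (Set.range ε) : Set K))
    (hstd : HasStandardValues p ϖ ε χ) (k : ℕ) (ξ : K) :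
    (∀ f : Fin k → F, χ (latticeHom ϖ F k f * ξ) = 1) ↔
      ∃ (m : ℕ) (g : Fin m → F), latticeHom ϖ F m g + ξ ∈ fracIdeal ϖ (k : ℤ) := by
  have hsplit : ∀ {m : ℕ} (f : Fin k → F) (g : Fin m → F),
      χ (latticeHom ϖ F k f * (latticeHom ϖ F m g + ξ)) = χ (latticeHom ϖ F k f * ξ) :=
    fun f g => by
      rw [mul_add, AddChar.map_add_eq_mul, char_mul_latticeHom hϖ hF hstd, one_mul]
  constructor
  · intro h
    obtain ⟨m, hm⟩ := exists_mem_fracIdeal hϖ ξ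
    obtain ⟨g, hg⟩ := exists_sub_latticeHom_mem hϖ hcard m hm
    -- Shifting `ξ` by `Λ` does not change its pairing with `Λ`, so `ξ` may be taken integral. Then
    -- `y ∈ ϖ^(-k) 𝒪` may in turn be replaced by its part in `Λ`.
    have hd : latticeHom ϖ F m (-g) + ξ ∈ fracIdeal ϖ 0 := by
      rwa [map_neg, neg_add_eq_sub]
    refine ⟨m, -g, ?_⟩
    by_contra hnot
    obtain ⟨y, hy, hy'⟩ := hχ.exists_ne_one hϖ hnot
    obtain ⟨f, hf⟩ := exists_sub_latticeHom_mem hϖ hcard k hy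
    refine hy' ?_
    set d := latticeHom ϖ F m (-g) + ξ with hdef
    have e : d * y = latticeHom ϖ F k f * d + d * (y - latticeHom ϖ F k f) := by ring
    rw [e, AddChar.map_add_eq_mul, hdef, hsplit, h, one_mul]
    have := mul_mem_fracIdeal hϖ hd hf
    rw [zero_add] at this
    exact hχ.eq_one this
  · rintro ⟨m, g, hg⟩ f
    rw [← hsplit f g]
    exact hχ.eq_one (by simpa using mul_mem_fracIdeal hϖ (latticeHom_mem_fracIdeal hϖ k f) hg)

theorem uDigit_zero : uDigit p ϖ ε 0 = 0 := by
  simp [uDigit]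

theorem u_eq_sum (hq : 1 < p ^ c) {k n : ℕ} (hn : n < (p ^ c) ^ k) :
    u p ϖ ε n = ∑ i ∈ Finset.range k, (ϖ⁻¹) ^ i * uDigit p ϖ ε (n / (p ^ c) ^ i % p ^ c) := by
  have hz : ∀ i, n < (p ^ c) ^ i →
      (ϖ⁻¹) ^ i * uDigit p ϖ ε (n / (p ^ c) ^ i % p ^ c) = 0 := fun i hi => by
    rw [Nat.div_eq_of_lt hi, Nat.zero_mod, uDigit_zero, mul_zero]
  have h1 : ∀ {a b : ℕ}, a ≤ b → n < (p ^ c) ^ a →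
      ∑ i ∈ Finset.range a, (ϖ⁻¹) ^ i * uDigit p ϖ ε (n / (p ^ c) ^ i % p ^ c) =
      ∑ i ∈ Finset.range b, (ϖ⁻¹) ^ i * uDigit p ϖ ε (n / (p ^ c) ^ i % p ^ c) :=
    fun hab ha => Finset.sum_subset (Finset.range_mono hab) fun i _ hi =>
      hz i (ha.trans_le (Nat.pow_le_pow_right (by omega) (by simpa using hi)))
  have hn1 : n < (p ^ c) ^ (n + 1) := n.lt_succ_self.trans (Nat.lt_pow_self hq)
  rw [u]
  rcases le_total (n + 1) k with h | h
  · exact h1 h hn1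
  · exact (h1 h hn).symm

theorem exists_digitEquiv [Fact p.Prime] [CharP K p]
    (hF : (F : Set K) = (AddSubgroup.closure (Set.range ε) : Set K)) (hcard : Nat.card F = p ^ c) :
    ∃ e : Fin (p ^ c) ≃ F, ∀ a : Fin (p ^ c), uDigit p ϖ ε (a : ℕ) = e a * ϖ⁻¹ := by
  have hp := Fact.out (p := p.Prime)
  have : NeZero p := ⟨hp.ne_zero⟩
  have : Finite F := Nat.finite_of_card_ne_zero (by rw [hcard]; exact pow_ne_zero _ hp.ne_zero)
  have : Fintype F := Fintype.ofFinite F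
  let s : ℕ → K := fun n => ∑ k : Fin c, ((n / p ^ (k : ℕ) % p : ℕ) : K) * ε k
  have hs : ∀ n, s n ∈ F := fun n => by
    rw [← SetLike.mem_coe, hF]
    refine sum_mem fun k _ => ?_
    rw [← nsmul_eq_mul]
    exact nsmul_mem (AddSubgroup.subset_closure (Set.mem_range_self k)) _
  let e : Fin (p ^ c) → F := fun a => ⟨s a, hs a⟩
  -- Integer coefficients are reduced modulo `p` to digits. Surjectivity and the cardinality `p ^ c`
  -- of `F` give injectivity.
  have hsurj : Function.Surjective e := by
    rintro ⟨x, hx⟩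
    have hx' : x ∈ Submodule.span ℤ (Set.range ε) := by
      rw [← Submodule.mem_toAddSubgroup, Submodule.span_int_eq_addSubgroupClosure,
        ← SetLike.mem_coe, ← hF]
      exact hx
    obtain ⟨a, rfl⟩ := (Submodule.mem_span_range_iff_exists_fun ℤ).1 hx'
    let b : Fin c → Fin p := fun k => ⟨(a k : ZMod p).val, ZMod.val_lt _⟩
    refine ⟨finFunctionFinEquiv b, Subtype.ext ?_⟩
    change ∑ k : Fin c, (((finFunctionFinEquiv b : ℕ) / p ^ (k : ℕ) % p : ℕ) : K) * ε k = _
    refine Finset.sum_congr rfl fun k _ => ?_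
    have h1 : (finFunctionFinEquiv b : ℕ) / p ^ (k : ℕ) % p = b k := by
      conv_rhs => rw [← Equiv.symm_apply_apply finFunctionFinEquiv b]
      rfl
    rw [h1, zsmul_eq_mul]
    congr 1
    change (((a k : ZMod p).val : ℕ) : K) = a k
    rw [ZMod.natCast_val, ZMod.cast_intCast (dvd_refl p)]
  refine ⟨Equiv.ofBijective e ((Fintype.bijective_iff_surjective_and_card e).2 ⟨hsurj, ?_⟩),
    fun a => rfl⟩
  rw [Fintype.card_fin, ← hcard, Nat.card_eq_fintype_card]

/-- Base `q` expansion identifies `{n < q ^ k}` with `Λ ∩ ϖ ^ (-k) 𝒪` through `n ↦ u n`. -/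
theorem exists_equiv_u_eq_latticeHom [Fact p.Prime] [CharP K p] (hc : c ≠ 0)
    (hF : (F : Set K) = (AddSubgroup.closure (Set.range ε) : Set K)) (hcard : Nat.card F = p ^ c)
    (k : ℕ) : ∃ e : Fin ((p ^ c) ^ k) ≃ (Fin k → F), ∀ n : Fin ((p ^ c) ^ k),
      u p ϖ ε (n : ℕ) = latticeHom ϖ F k (e n) := by
  obtain ⟨e, he⟩ := exists_digitEquiv (ϖ := ϖ) (ε := ε) hF hcard
  refine ⟨finFunctionFinEquiv.symm.trans (Equiv.piCongrRight fun _ => e), fun n => ?_⟩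
  rw [u_eq_sum (Nat.one_lt_pow hc (Fact.out (p := p.Prime)).one_lt) n.2, latticeHom_apply,
    Finset.sum_range]
  refine Finset.sum_congr rfl fun i _ => ?_
  have h1 : (n : ℕ) / (p ^ c) ^ (i : ℕ) % p ^ c = (finFunctionFinEquiv.symm n i : ℕ) := rfl
  rw [h1, he]
  simp only [Equiv.trans_apply, Equiv.piCongrRight_apply, Pi.map_apply]
  rw [zpow_neg, ← Int.natCast_succ, zpow_natCast, pow_succ, inv_pow, mul_inv]
  ring

end Lattice

/-! ### From orthogonality of the lattice characters to a tiling. -/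

section Tiling

/-- The sum counts an overlap at least twice, so `2 μ(A) ≤ μ(A)` with `μ(A)` finite. -/
theorem aedisjoint_of_sum_restrict_eq {α : Type*} [MeasurableSpace α] {μ : Measure α}
    {T : ℕ → Set α} (hT : ∀ n, MeasurableSet (T n)) (hfin : ∀ n, μ (T n) ≠ ∞)
    (h : Measure.sum (fun n => μ.restrict (T n)) = μ) :
    Pairwise (fun s t => AEDisjoint μ (T s) (T t)) := by
  intro s t hst
  by_contra hne
  have hA : MeasurableSet (T s ∩ T t) := (hT s).inter (hT t)
  have h1 : ∑ n ∈ ({s, t} : Finset ℕ), μ ((T s ∩ T t) ∩ T n) ≤ μ (T s ∩ T t) := by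
    conv_rhs => rw [← h, Measure.sum_apply _ hA]
    simp_rw [Measure.restrict_apply hA]
    exact ENNReal.sum_le_tsum _
  rw [Finset.sum_pair hst, Set.inter_eq_left.2 Set.inter_subset_left,
    Set.inter_eq_left.2 Set.inter_subset_right] at h1
  have hlt : μ (T s ∩ T t) < ∞ := (measure_mono Set.inter_subset_left).trans_lt (hfin s).lt_top
  exact (ENNReal.lt_add_right hlt.ne hne).not_ge h1

theorem iUnion_ae_eq_univ_of_sum_restrict_eq {α : Type*} [MeasurableSpace α] {μ : Measure α}
    {T : ℕ → Set α} (hT : ∀ n, MeasurableSet (T n))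
    (h : Measure.sum (fun n => μ.restrict (T n)) = μ) :
    (⋃ n, T n) =ᵐ[μ] (Set.univ : Set α) := by
  have hA : MeasurableSet (⋃ n, T n)ᶜ := (MeasurableSet.iUnion hT).compl
  rw [ae_eq_univ, ← h, Measure.sum_apply _ hA]
  refine ENNReal.tsum_eq_zero.2 fun n => ?_
  rw [Measure.restrict_apply hA, (Set.disjoint_compl_left_iff_subset.2
    (Set.subset_iUnion T n)).inter_eq, measure_empty]

variable {K : Type*} [Field K] [ValuativeRel K] [TopologicalSpace K] [IsNonarchimedeanLocalField K]
  [MeasurableSpace K] [BorelSpace K] [SecondCountableTopology K]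
  {p c : ℕ} {ϖ : K} {ε : Fin c → K} {χ : AddChar K Circle} {F : Subfield K}
  {μ : Measure K} [μ.IsAddHaarMeasure]

/-- The coset `a + ϖ ^ k 𝒪[K]`. -/
def coset (ϖ a : K) (k : ℤ) : Set K := {x | x - a ∈ fracIdeal ϖ k}

theorem mem_coset {a x : K} {k : ℤ} : x ∈ coset ϖ a k ↔ x - a ∈ fracIdeal ϖ k := by
  rw [coset, Set.mem_ofPred_eq]

theorem isOpen_coset (hϖ : IsPrimeElement ϖ) (a : K) (k : ℤ) : IsOpen (coset ϖ a k) :=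
  (isOpen_fracIdeal hϖ k).preimage (continuous_sub_right a)

theorem coset_eq_of_mem {a b : K} {k : ℤ} (h : b ∈ coset ϖ a k) : coset ϖ a k = coset ϖ b k := by
  ext x
  rw [mem_coset] at h
  rw [mem_coset, mem_coset, ← sub_add_sub_cancel x b a, add_mem_cancel_right h]

theorem isTopologicalBasis_coset (hϖ : IsPrimeElement ϖ) :
    TopologicalSpace.IsTopologicalBasis (Set.range fun i : K × ℕ => coset ϖ i.1 i.2) := by
  refine TopologicalSpace.isTopologicalBasis_of_isOpen_of_nhds ?_ fun a U ha hU => ?_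
  · rintro _ ⟨i, rfl⟩
    exact isOpen_coset hϖ _ _
  · have h1 : (fun x => x + a) ⁻¹' U ∈ 𝓝 (0 : K) :=
      (continuous_add_const a).continuousAt.preimage_mem_nhds (by simpa using hU.mem_nhds ha)
    obtain ⟨k, -, hk⟩ := (hasBasis_nhds_zero_fracIdeal hϖ).mem_iff.1 h1
    refine ⟨_, ⟨(a, k), rfl⟩, mem_coset.2 (by simp), fun x hx => ?_⟩
    simpa using hk (mem_coset.1 hx)

/-- Cosets that meet are nested, so they form a π-system; they are also a topological basis, hence
generate the Borel sets. -/
theorem measure_ext_of_coset (hϖ : IsPrimeElement ϖ) {ν ν' : Measure K}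
    (hfin : ∀ a, ν (coset ϖ a 0) ≠ ∞) (h : ∀ a (k : ℕ), ν (coset ϖ a k) = ν' (coset ϖ a k)) :
    ν = ν' := by
  have hpi : IsPiSystem (Set.range fun i : K × ℕ => coset ϖ i.1 i.2) := by
    rintro _ ⟨⟨a, k⟩, rfl⟩ _ ⟨⟨b, l⟩, rfl⟩ ⟨x, hxa, hxb⟩
    dsimp only at *
    rw [coset_eq_of_mem hxa, coset_eq_of_mem hxb]
    refine ⟨(x, max k l), ?_⟩
    ext y
    simp only [Set.mem_inter_iff, mem_coset]
    constructor
    · intro hy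
      exact ⟨fracIdeal_anti hϖ (by simp) hy, fracIdeal_anti hϖ (by simp) hy⟩
    · rintro ⟨h1, h2⟩
      rcases le_total k l with hkl | hkl
      · rwa [max_eq_right hkl]
      · rwa [max_eq_left hkl]
  obtain ⟨d, hd⟩ := TopologicalSpace.exists_dense_seq K
  refine Measure.ext_of_generateFrom_of_iUnion _ (fun n => coset ϖ (d n) 0)
    ?_ hpi (Set.eq_univ_of_forall fun x => ?_) (fun n => ⟨(d n, 0), rfl⟩) (fun n => hfin _) ?_
  · rw [BorelSpace.measurable_eq (α := K), (isTopologicalBasis_coset hϖ).borel_eq_generateFrom]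
  · obtain ⟨n, hn⟩ := hd.exists_mem_open (isOpen_coset hϖ x 0) ⟨x, mem_coset.2 (by simp)⟩
    refine Set.mem_iUnion.2 ⟨n, ?_⟩
    rw [mem_coset, ← neg_sub, neg_mem_iff]
    exact mem_coset.1 hn
  · rintro _ ⟨⟨a, k⟩, rfl⟩
    exact h a k

/-- The hypotheses on prime element, coefficients and standard character under which the
translations `u n` enumerate a lattice that is its own annihilator. -/
structure IsSelfDualSetup (p : ℕ) {c : ℕ} [NeZero c] (ϖ : K) (ε : Fin c → K)
    (χ : AddChar K Circle) (F : Subfield K) : Prop where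
  prime : IsPrimeElement ϖ
  base : IsBaseCharacter ϖ χ
  coe_eq : (F : Set K) = (AddSubgroup.closure (Set.range ε) : Set K)
  card_eq : Nat.card F = p ^ c
  card_residue : Nat.card F = Nat.card 𝓀[K]
  values : HasStandardValues p ϖ ε χ
  injective : Function.Injective (u p ϖ ε)

namespace IsSelfDualSetup

variable [Fact p.Prime] [CharP K p] [NeZero c]

theorem finite (h : IsSelfDualSetup p ϖ ε χ F) : Finite F :=
  Nat.finite_of_card_ne_zero (by
    rw [h.card_eq]
    exact pow_ne_zero _ (Fact.out (p := p.Prime)).ne_zero)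

theorem exists_equiv (h : IsSelfDualSetup p ϖ ε χ F) (k : ℕ) :
    ∃ e : Fin ((p ^ c) ^ k) ≃ (Fin k → F), ∀ n : Fin ((p ^ c) ^ k),
      u p ϖ ε (n : ℕ) = latticeHom ϖ F k (e n) :=
  exists_equiv_u_eq_latticeHom (NeZero.ne c) h.coe_eq h.card_eq k

theorem latticeHom_injective (h : IsSelfDualSetup p ϖ ε χ F) (k : ℕ) :
    Function.Injective (latticeHom ϖ F k) := by
  obtain ⟨e, he⟩ := h.exists_equiv k
  intro f g hfg
  have h1 : u p ϖ ε (e.symm f : ℕ) = u p ϖ ε (e.symm g : ℕ) := by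
    rw [he, he, e.apply_symm_apply, e.apply_symm_apply, hfg]
  exact e.symm.injective (Fin.ext (h.injective h1))

theorem exists_u_eq (h : IsSelfDualSetup p ϖ ε χ F) {k : ℕ} (f : Fin k → F) :
    ∃ n, u p ϖ ε n = latticeHom ϖ F k f := by
  obtain ⟨e, he⟩ := h.exists_equiv k
  exact ⟨e.symm f, by rw [he, e.apply_symm_apply]⟩

theorem exists_latticeHom_eq (h : IsSelfDualSetup p ϖ ε χ F) {k n : ℕ} (hn : n ≤ k) :
    ∃ f, latticeHom ϖ F k f = u p ϖ ε n := by
  obtain ⟨e, he⟩ := h.exists_equiv k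
  have hq := Nat.one_lt_pow (NeZero.ne c) (Fact.out (p := p.Prime)).one_lt
  exact ⟨e ⟨n, hn.trans_lt (Nat.lt_pow_self hq)⟩, (he _).symm⟩

theorem eq_of_u_sub_mem (h : IsSelfDualSetup p ϖ ε χ F) {m n : ℕ}
    (hmn : u p ϖ ε m - u p ϖ ε n ∈ fracIdeal ϖ 0) : m = n := by
  have := h.finite
  obtain ⟨f, hf⟩ := h.exists_latticeHom_eq (le_max_left m n)
  obtain ⟨g, hg⟩ := h.exists_latticeHom_eq (le_max_right m n)
  rw [← hf, ← hg, ← map_sub] at hmn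
  have h0 := latticeHom_eq_zero_of_mem_fracIdeal h.prime h.base h.card_residue h.coe_eq h.values hmn
  rw [map_sub, sub_eq_zero, hf, hg] at h0
  exact h.injective h0

/-- The points `ξ` with `u n + ξ ∈ a + ϖ ^ k 𝒪` for some `n`, described by characters. -/
theorem sum_char_latticeHom [Fintype F] (h : IsSelfDualSetup p ϖ ε χ F) (k : ℕ) (a ξ : K) :
    ∑ f : Fin k → F, (χ (latticeHom ϖ F k f * (ξ - a)) : ℂ) =
      (⋃ n, {ξ | u p ϖ ε n + ξ ∈ coset ϖ a k}).indicator (fun _ => ((p ^ c) ^ k : ℂ)) ξ := by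
  classical
  -- A character of a finite group sums to the group order or to zero; triviality of `ψ` is decided
  -- by the annihilator lemma.
  let ψ : AddChar (Fin k → F) ℂ := (Circle.coeHom.compAddChar χ).compAddMonoidHom
    ((AddMonoidHom.mulRight (ξ - a)).comp (latticeHom ϖ F k))
  have hψ : ∀ f, ψ f = (χ (latticeHom ϖ F k f * (ξ - a)) : ℂ) := fun f => rfl
  have hiff : ψ = 0 ↔ ξ ∈ ⋃ n, {ξ | u p ϖ ε n + ξ ∈ coset ϖ a k} := by
    have h1 : ψ = 0 ↔ ∀ f, χ (latticeHom ϖ F k f * (ξ - a)) = 1 := by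
      rw [DFunLike.ext_iff]
      refine forall_congr' fun f => ?_
      rw [hψ, AddChar.zero_apply, Circle.coe_eq_one]
    rw [h1, forall_char_latticeHom_mul_eq_one_iff h.prime h.base h.card_residue h.coe_eq h.values,
      Set.mem_iUnion]
    simp only [Set.mem_ofPred_eq, mem_coset, add_sub_assoc]
    constructor
    · rintro ⟨m, g, hg⟩
      obtain ⟨n, hn⟩ := h.exists_u_eq g
      exact ⟨n, by rwa [hn]⟩
    · rintro ⟨n, hn⟩
      obtain ⟨g, hg⟩ := h.exists_latticeHom_eq (le_refl n)
      exact ⟨n, g, by rwa [hg]⟩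
  simp_rw [← hψ]
  rw [AddChar.sum_eq_ite]
  simp only [hiff]
  rw [Set.indicator_apply, Fintype.card_fun, Fintype.card_fin, ← Nat.card_eq_fintype_card,
    h.card_eq]
  push_cast
  rfl

/-- Integrate the character sum over `S`: only the term `f = 0` survives and contributes `μ S = 1`,
while the indicator form gives `q^k` times the measure sought. -/
theorem measure_inter_iUnion (h : IsSelfDualSetup p ϖ ε χ F) {S : Set K}
    (hS1 : μ S = 1)
    (horth : ∀ (k : ℕ) (f : Fin k → F), f ≠ 0 → ∫ ξ in S, (χ (latticeHom ϖ F k f * ξ) : ℂ) ∂μ = 0)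
    (k : ℕ) (a : K) :
    μ (S ∩ ⋃ n, {ξ | u p ϖ ε n + ξ ∈ coset ϖ a k}) = (((p ^ c) ^ k : ℕ) : ℝ≥0∞)⁻¹ := by
  have := h.finite
  have : Fintype F := Fintype.ofFinite F
  set E := ⋃ n, {ξ | u p ϖ ε n + ξ ∈ coset ϖ a k} with hEdef
  have hE : MeasurableSet E := MeasurableSet.iUnion fun n =>
    ((isOpen_coset h.prime a k).preimage (continuous_const_add _)).measurableSet
  have hq : (((p ^ c) ^ k : ℕ) : ℝ) ≠ 0 := by
    exact_mod_cast pow_ne_zero _ (pow_ne_zero _ (Fact.out (p := p.Prime)).ne_zero)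
  have : IsFiniteMeasure (μ.restrict S) := ⟨by simp [hS1]⟩
  have h1 : ∫ ξ in S, ∑ f : Fin k → F, (χ (latticeHom ϖ F k f * (ξ - a)) : ℂ) ∂μ = 1 := by
    rw [integral_finsetSum]
    · rw [Finset.sum_eq_single 0]
      · simp [measureReal_def, hS1]
      · intro f _ hf
        have e : ∀ ξ, (χ (latticeHom ϖ F k f * (ξ - a)) : ℂ) =
            χ (-(latticeHom ϖ F k f * a)) * χ (latticeHom ϖ F k f * ξ) := fun ξ => by
          rw [← Circle.coe_mul, ← AddChar.map_add_eq_mul]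
          congr 2
          ring
        simp_rw [e]
        rw [integral_const_mul, horth k f hf, mul_zero]
      · simp
    · intro f _
      refine (integrable_const (1 : ℝ)).mono' ?_ (Eventually.of_forall fun ξ => ?_)
      · exact (continuous_subtype_val.comp (h.base.continuous.comp
          (by fun_prop : Continuous fun ξ => latticeHom ϖ F k f * (ξ - a)))).aestronglyMeasurable
      · exact (Circle.norm_coe _).le
  simp_rw [h.sum_char_latticeHom] at h1
  rw [integral_indicator hE, setIntegral_const, measureReal_restrict_apply hE, Set.inter_comm,
    Complex.real_smul] at h1
  have h2 : μ.real (S ∩ E) * (((p ^ c) ^ k : ℕ) : ℝ) = 1 := by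
    have h3 : ((μ.real (S ∩ E) * (((p ^ c) ^ k : ℕ) : ℝ) : ℝ) : ℂ) = 1 := by
      rw [← h1]
      push_cast
      rfl
    exact_mod_cast h3
  have hfin : μ (S ∩ E) ≠ ∞ :=
    ((measure_mono Set.inter_subset_left).trans_lt (by simp [hS1])).ne
  rw [← ENNReal.ofReal_toReal hfin, ← measureReal_def, eq_inv_of_mul_eq_one_left h2,
    ENNReal.ofReal_inv_of_pos (by positivity), ENNReal.ofReal_natCast]

theorem sum_restrict_vadd_coset (h : IsSelfDualSetup p ϖ ε χ F) {S : Set K} (hS : MeasurableSet S)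
    (hS1 : μ S = 1)
    (horth : ∀ (k : ℕ) (f : Fin k → F), f ≠ 0 → ∫ ξ in S, (χ (latticeHom ϖ F k f * ξ) : ℂ) ∂μ = 0)
    (k : ℕ) (a : K) :
    Measure.sum (fun n => μ.restrict (u p ϖ ε n +ᵥ S)) (coset ϖ a k) =
      (((p ^ c) ^ k : ℕ) : ℝ≥0∞)⁻¹ := by
  have hB : MeasurableSet (coset ϖ a k) := (isOpen_coset h.prime a k).measurableSet
  rw [← h.measure_inter_iUnion hS1 horth k a, Measure.sum_apply _ hB, Set.inter_iUnion,
    measure_iUnion]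
  · refine tsum_congr fun n => ?_
    rw [Measure.restrict_apply hB, ← measure_preimage_add μ (u p ϖ ε n)]
    congr 1
    ext ξ
    rw [Set.mem_preimage, Set.mem_inter_iff, Set.mem_inter_iff, Set.mem_ofPred_eq, and_comm,
      ← vadd_eq_add, Set.vadd_mem_vadd_set_iff]
  -- Distinct lattice points are incongruent modulo `𝒪`, so the shifted cosets are disjoint.
  · intro m n hmn
    refine Set.disjoint_left.2 fun ξ h1 h2 => hmn (h.eq_of_u_sub_mem ?_)
    have h1' := mem_coset.1 h1.2
    have h2' := mem_coset.1 h2.2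
    have := fracIdeal_anti h.prime (Int.natCast_nonneg k) (sub_mem h1' h2')
    rwa [sub_sub_sub_cancel_right, add_sub_add_right_eq_sub] at this
  · exact fun n => hS.inter
      ((isOpen_coset h.prime a k).preimage (continuous_const_add _)).measurableSet

theorem sum_restrict_vadd_integers (h : IsSelfDualSetup p ϖ ε χ F) :
    Measure.sum (fun n => μ.restrict (u p ϖ ε n +ᵥ (𝒪[K] : Set K))) = μ := by
  have := h.finite
  rw [← coe_fracIdeal_zero (ϖ := ϖ)]
  have hm : ∀ n, MeasurableSet (u p ϖ ε n +ᵥ (fracIdeal ϖ 0 : Set K)) := fun n =>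
    (measurableSet_fracIdeal h.prime 0).const_vadd _
  rw [← Measure.restrict_iUnion _ hm]
  · have : (⋃ n, u p ϖ ε n +ᵥ (fracIdeal ϖ 0 : Set K)) = Set.univ := by
      refine Set.eq_univ_of_forall fun x => ?_
      obtain ⟨k, hk⟩ := exists_mem_fracIdeal h.prime x
      obtain ⟨f, hf⟩ := exists_sub_latticeHom_mem h.prime h.card_residue k hk
      obtain ⟨n, hn⟩ := h.exists_u_eq f
      refine Set.mem_iUnion.2 ⟨n, x - latticeHom ϖ F k f, hf, ?_⟩
      simp [hn]
    rw [this, Measure.restrict_univ]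
  · intro m n hmn
    refine Set.disjoint_left.2 ?_
    rintro _ ⟨x, hx, rfl⟩ ⟨y, hy, hxy⟩
    refine hmn (h.eq_of_u_sub_mem ?_)
    have : u p ϖ ε m - u p ϖ ε n = y - x := by
      simp only [vadd_eq_add] at hxy
      linear_combination -hxy
    rw [this]
    exact sub_mem hy hx

/-- A set of measure one on which the characters of the lattice are orthogonal tiles `K`. -/
theorem sum_restrict_vadd_eq (h : IsSelfDualSetup p ϖ ε χ F) (hμ : μ (𝒪[K] : Set K) = 1)
    {S : Set K} (hS : MeasurableSet S) (hS1 : μ S = 1)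
    (horth : ∀ (k : ℕ) (f : Fin k → F), f ≠ 0 →
      ∫ ξ in S, (χ (latticeHom ϖ F k f * ξ) : ℂ) ∂μ = 0) :
    Measure.sum (fun n => μ.restrict (u p ϖ ε n +ᵥ S)) = μ := by
  have := h.finite
  refine Eq.trans ?_ h.sum_restrict_vadd_integers
  -- `𝒪` is the model tile: a nonzero lattice element is not integral, so its character is
  -- nontrivial on `𝒪`.
  have hO : ∀ (k : ℕ) (f : Fin k → F), f ≠ 0 →
      ∫ ξ in (𝒪[K] : Set K), (χ (latticeHom ϖ F k f * ξ) : ℂ) ∂μ = 0 := fun k f hf => by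
    have h1 := setIntegral_char_fracIdeal (μ := μ) h.prime h.base 0 (latticeHom ϖ F k f)
    rw [neg_zero, coe_fracIdeal_zero, Set.indicator_of_notMem] at h1
    · exact h1
    · intro hmem
      have h2 := latticeHom_eq_zero_of_mem_fracIdeal h.prime h.base h.card_residue h.coe_eq
        h.values (mem_fracIdeal_zero.2 hmem)
      exact hf (h.latticeHom_injective k (by rw [h2, map_zero]))
  have hOm : MeasurableSet (𝒪[K] : Set K) := by
    rw [← coe_fracIdeal_zero (ϖ := ϖ)]
    exact measurableSet_fracIdeal h.prime 0
  refine measure_ext_of_coset h.prime (fun a => ?_) fun a k => ?_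
  · have := h.sum_restrict_vadd_coset hS hS1 horth 0 a
    rw [Nat.cast_zero] at this
    rw [this]
    simp
  · rw [h.sum_restrict_vadd_coset hS hS1 horth, h.sum_restrict_vadd_coset hOm hμ hO]

end IsSelfDualSetup

end Tiling

/-! ### Orthonormality of the translates read as character integrals over `S`. -/

section ScalingSet

variable {K : Type*} [Field K] [ValuativeRel K] [TopologicalSpace K] [IsNonarchimedeanLocalField K]
  [MeasurableSpace K] [BorelSpace K] [SecondCountableTopology K]
  {ϖ : K} {χ : AddChar K Circle} {μ : Measure K} [μ.IsAddHaarMeasure]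

theorem inner_translate_translate (hϖ : IsPrimeElement ϖ) (hμ : μ (𝒪[K] : Set K) = 1)
    (hχ : IsBaseCharacter ϖ χ) {S : Set K} (hS : MeasurableSet S) {φ : Lp ℂ 2 μ}
    (hφ : IsFourierTransform χ μ φ (S.indicator fun _ => (1 : ℂ))) (a b : K) :
    inner ℂ (translate μ a φ) (translate μ b φ) = ∫ ξ in S, (χ ((a - b) * ξ) : ℂ) ∂μ := by
  rw [← (fourierL2 hϖ hμ hχ).inner_map_map, L2.inner_def, ← integral_indicator hS]
  refine integral_congr_ae ?_
  filter_upwards [fourierL2_translate_ae_eq hϖ hμ hχ hφ a,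
    fourierL2_translate_ae_eq hϖ hμ hχ hφ b] with ξ h1 h2
  rw [h1, h2, RCLike.inner_apply]
  by_cases hξ : ξ ∈ S
  · have e : (a - b) * ξ = -(b * ξ) + a * ξ := by ring
    simp only [Set.indicator_of_mem hξ, mul_one]
    rw [e, AddChar.map_add_eq_mul, Circle.coe_mul, AddChar.map_neg_eq_inv χ (a * ξ),
      Circle.coe_inv_eq_conj, Complex.conj_conj]
  · simp [hξ]

theorem IsMRA.sum_restrict_vadd_eq {p c : ℕ} [Fact p.Prime] [CharP K p] [NeZero c]
    {ε : Fin c → K} {V : ℤ → Submodule ℂ (Lp ℂ 2 μ)} {φ : Lp ℂ 2 μ}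
    (hV : IsMRA μ ϖ (u p ϖ ε) V φ) (hϖ : IsPrimeElement ϖ) (hμ : μ (𝒪[K] : Set K) = 1)
    (hχ : IsBaseCharacter ϖ χ) (hc : Nat.card 𝓀[K] = p ^ c) (hε : IsResidueBasis p ε)
    (hstd : HasStandardValues p ϖ ε χ) {S : Set K} (hS : MeasurableSet S)
    (hφ : IsFourierTransform χ μ φ (S.indicator fun _ => (1 : ℂ))) :
    μ S = 1 ∧ Measure.sum (fun n => μ.restrict (u p ϖ ε n +ᵥ S)) = μ := by
  obtain ⟨-, F, hcard, hF⟩ := hε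
  have horth := orthonormal_iff_ite.1 hV.orthonormal
  simp_rw [inner_translate_translate hϖ hμ hχ hS hφ] at horth
  have hS1 : μ S = 1 := by
    have h1 := horth 0 0
    simp only [sub_self, zero_mul, AddChar.map_zero_eq_one, Circle.coe_one, if_true,
      setIntegral_const, Complex.real_smul, mul_one, Complex.ofReal_eq_one] at h1
    -- Finiteness of `μ S` comes for free, since `∞` has real value `0`.
    rwa [measureReal_def, ENNReal.toReal_eq_one_iff] at h1
  have hsetup : IsSelfDualSetup p ϖ ε χ F :=
    { prime := hϖ
      base := hχ
      coe_eq := hF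
      card_eq := hcard
      card_residue := hcard.trans hc.symm
      values := hstd
      -- Orthonormal vectors are distinct, so equal translations have equal indices.
      injective := fun m n hmn => hV.orthonormal.linearIndependent.injective (by simp only [hmn]) }
  refine ⟨hS1, hsetup.sum_restrict_vadd_eq hμ hS hS1 fun k f hf => ?_⟩
  obtain ⟨n, hn⟩ := hsetup.exists_u_eq f
  have hu0 : u p ϖ ε 0 = 0 := by simp [u, uDigit]
  have hn0 : n ≠ 0 := by
    rintro rfl
    exact hf (hsetup.latticeHom_injective k (by rw [← hn, hu0, map_zero]))
  simpa [hu0, hn, hn0] using horth n 0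

end ScalingSet

end LocalFieldMRA

theorem mainTheorem6 {K : Type*} [Field K] [ValuativeRel K] [TopologicalSpace K]
    [IsNonarchimedeanLocalField K] [MeasurableSpace K] [BorelSpace K]
    (p : ℕ) [Fact p.Prime] [CharP K p]
    (c : ℕ) [NeZero c] (hc : Nat.card 𝓀[K] = p ^ c)
    (μ : Measure K) [μ.IsAddHaarMeasure] (hμ : μ (𝒪[K] : Set K) = 1)
    (ϖ : K) (hϖ : LocalFieldMRA.IsPrimeElement ϖ)
    (ε : Fin c → K) (hε : LocalFieldMRA.IsResidueBasis p ε)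
    (χ : AddChar K Circle) (hχ : LocalFieldMRA.IsBaseCharacter ϖ χ)
    (S : Set K) (hS : LocalFieldMRA.IsScalingSet μ χ ϖ (LocalFieldMRA.u p ϖ ε) S) :
    (∀ j : ℤ, (ϖ ^ (-j) • S : Set K) ≤ᵐ[μ] (ϖ ^ (-(j + 1)) • S : Set K)) ∧
    (∀ᵐ ξ ∂μ, ∀ᶠ j : ℤ in atTop, ξ ∈ (ϖ ^ (-j) • S : Set K)) ∧
    (LocalFieldMRA.HasStandardValues p ϖ ε χ →
      Pairwise (fun s t : ℕ => AEDisjoint μ (LocalFieldMRA.u p ϖ ε s +ᵥ S)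
        (LocalFieldMRA.u p ϖ ε t +ᵥ S)) ∧
      (⋃ t : ℕ, (LocalFieldMRA.u p ϖ ε t +ᵥ S)) =ᵐ[μ] (Set.univ : Set K) ∧
      (⋃ t : ℕ, (LocalFieldMRA.u p ϖ ε t +ᵥ S) ∩ (𝒪[K] : Set K)) =ᵐ[μ] (𝒪[K] : Set K)) := by
  have := LocalFieldMRA.secondCountableTopology hϖ
  obtain ⟨hSm, V, φ, hV, hφ⟩ := hS
  have hinc := hV.ae_le_smul hϖ hμ hχ hSm hφ
  refine ⟨fun j => ?_, ?_, fun hstd => ?_⟩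
  · rw [ae_le_set, measure_eq_zero_iff_ae_notMem]
    filter_upwards [hinc j] with ξ h h'
    exact h'.2 (h h'.1)
  · filter_upwards [ae_all_iff.2 hinc, hV.ae_exists_mem_smul hϖ hμ hχ hSm hφ] with ξ h1 ⟨n, hn⟩
    filter_upwards [eventually_ge_atTop (n : ℤ)] with j hj
    -- The inclusions hold at almost every `ξ` for all of the countably many `j` at once, so
    -- membership propagates upwards from `n`.
    exact Int.leInduction (motive := fun j _ => ξ ∈ (ϖ ^ (-j) • S : Set K)) hn
      (fun k _ hk => h1 k hk) j hj
  · obtain ⟨hS1, hsum⟩ := hV.sum_restrict_vadd_eq hϖ hμ hχ hc hε hstd hSm hφ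
    have hT : ∀ n, MeasurableSet (LocalFieldMRA.u p ϖ ε n +ᵥ S) := fun n => hSm.const_vadd _
    have huniv := LocalFieldMRA.iUnion_ae_eq_univ_of_sum_restrict_eq hT hsum
    refine ⟨LocalFieldMRA.aedisjoint_of_sum_restrict_eq hT (fun n => ?_) hsum, huniv, ?_⟩
    · rw [measure_vadd, hS1]
      exact ENNReal.one_ne_top
    · rw [← Set.iUnion_inter]
      simpa using ae_eq_set_inter huniv (ae_eq_refl (𝒪[K] : Set K))
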